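/- Theorem (Goodstein 1944, over $\mathrm{RCA}_0$). Over $\mathrm{RCA}_0$ the following two statements are equivalent; that is, in every model $(M,\mathcal S)$ of $\mathrm{RCA}_0$ (with $M$ possibly nonstandard and $\mathcal S\subseteq\mathcal P(M)$ the range of the set variables) the one holds if and only if the other does. By Gödel's completeness theorem this says that $\mathrm{RCA}_0$ proves their equivalence. (i) Every Goodstein sequence terminates: for every non-decreasing $f:\mathbb N\to\mathbb N$ with $f(0)\ge 2$ and every sequence $(m_i)_{i\in\mathbb N}$ of natural numbers with $$m_{i+1}=S^{f(i)}_{f(i+1)}(m_i)\mathbin{\dot-}1\quad\text{for all } i,$$ there is $k$ such that $m_i=0$ for all $i\ge k$. (ii) There is no infinite descending sequence $\varepsilon_0>\alpha_0>\alpha_1>\alpha_2>\cdots$ of ordinals below $\varepsilon_0$. Here, for $c\ge b\ge 2$, $S^b_c(m)$ is the number obtained from $m$ by replacing the base $b$ by $c$ everywhere in the complete $b$-representation of $m$ (in which the exponents are written in base $b$ as well, and so on), so that $S^b_c(0)=0$ and $S^b_c(b^n\cdot k+r)=c^{S^b_c(n)}\cdot k+S^b_c(r)$ for $0<k<b$ and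 $r<b^n$; and $x\mathbin{\dot-}1$ is $x-1$ if $x>0$ and $0$ if $x=0$. Ordinals below $\varepsilon_0$ are represented in $\mathrm{RCA}_0$ by (codes of) complete Cantor normal forms $\omega^{\alpha_1}\cdot k_1+\dots+\omega^{\alpha_n}\cdot k_n$ with $\alpha_1>\dots>\alpha_n$ again complete Cantor normal forms and $k_i>0$; they are compared lexicographically from the left, at each place first by the exponent and then by the coefficient, a proper initial part of a sum being smaller than the sum. Functions and sequences are those of the model, i.e. those whose graph is a set in $\mathcal S$. -/

import Mathlib

/-! Second-order arithmetic, the system `RCA₀`, and, inside an arbitrary model of it, Goodstein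
sequences and Cantor normal forms below `ε₀`.

A structure for the language of second-order arithmetic consists of a type `M` of numbers with
interpretations of `0`, `1`, `+`, `*`, `<`, and of a collection `S` of subsets of `M`, the range of
the set variables. `M` may be nonstandard, and `S` need not contain all subsets of `M`. -/

universe u

namespace SecondOrderArith

/-- Number terms; the number variables are de Bruijn indices. -/
inductive NumTerm : Type
  | var (i : ℕ) : NumTerm
  | zero : NumTerm
  | one : NumTerm
  | add (s t : NumTerm) : NumTerm
  | mul (s t : NumTerm) : NumTerm

/-- Formulas with bounded number quantifiers only and without set quantifiers. The bounded
quantifiers bind the variable `0` of their body; their bound is read outside of the quantifier.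
Set variables, which are always free here, are numbered by `ℕ`. -/
inductive BddFormula : Type
  | eq (s t : NumTerm) : BddFormula
  | lt (s t : NumTerm) : BddFormula
  | mem (t : NumTerm) (X : ℕ) : BddFormula
  | not (φ : BddFormula) : BddFormula
  | and (φ ψ : BddFormula) : BddFormula
  | or (φ ψ : BddFormula) : BddFormula
  | allLt (t : NumTerm) (φ : BddFormula) : BddFormula
  | exLt (t : NumTerm) (φ : BddFormula) : BddFormula

/-- The assignment that gives the variable `0` the value `a` and the variable `i + 1` the value
`v i`. -/
def push {M : Type u} (a : M) (v : ℕ → M) : ℕ → M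
  | 0 => a
  | i + 1 => v i

/-- The value of a number term under an assignment. -/
def NumTerm.val {M : Type u} [Zero M] [One M] [Add M] [Mul M] (v : ℕ → M) : NumTerm → M
  | .var i => v i
  | .zero => 0
  | .one => 1
  | .add s t => s.val v + t.val v
  | .mul s t => s.val v * t.val v

/-- Truth of a bounded formula under an assignment `v` of the number variables and an assignment
`W` of the set variables. -/
def BddFormula.Holds {M : Type u} [Zero M] [One M] [Add M] [Mul M] [LT M] (W : ℕ → Set M) :
    BddFormula → (ℕ → M) → Prop
  | .eq s t, v => s.val v = t.val v
  | .lt s t, v => s.val v < t.val v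
  | .mem t X, v => t.val v ∈ W X
  | .not φ, v => ¬ φ.Holds W v
  | .and φ ψ, v => φ.Holds W v ∧ ψ.Holds W v
  | .or φ ψ, v => φ.Holds W v ∨ ψ.Holds W v
  | .allLt t φ, v => ∀ a : M, a < t.val v → φ.Holds W (push a v)
  | .exLt t φ, v => ∃ a : M, a < t.val v ∧ φ.Holds W (push a v)

/-- `(M, S)` is a model of `RCA₀`: the basic axioms, induction for `Σ⁰₁` formulas `∃ m, θ(m, x)`,
and comprehension for `Δ⁰₁` predicates, that is for `Σ⁰₁` formulas `∃ m, θ(m, x)` that are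
equivalent in the model to a `Π⁰₁` formula `∀ m, η(m, x)`. Here `θ` and `η` are bounded formulas,
with parameters (the values of `v` and `W`) from `M` and from `S`. -/
structure ModelsRCA0 {M : Type u} [Zero M] [One M] [Add M] [Mul M] [LT M] (S : Set (Set M)) :
    Prop where
  succ_ne_zero : ∀ x : M, x + 1 ≠ 0
  succ_inj : ∀ x y : M, x + 1 = y + 1 → x = y
  add_zero : ∀ x : M, x + 0 = x
  add_succ : ∀ x y : M, x + (y + 1) = (x + y) + 1
  mul_zero : ∀ x : M, x * 0 = 0
  mul_succ : ∀ x y : M, x * (y + 1) = x * y + x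
  not_lt_zero : ∀ x : M, ¬ x < 0
  lt_succ : ∀ x y : M, x < y + 1 ↔ x < y ∨ x = y
  sigma_induction : ∀ (θ : BddFormula) (v : ℕ → M) (W : ℕ → Set M), (∀ i, W i ∈ S) →
    (∃ m, θ.Holds W (push m (push 0 v))) →
    (∀ x, (∃ m, θ.Holds W (push m (push x v))) → ∃ m, θ.Holds W (push m (push (x + 1) v))) →
    ∀ x, ∃ m, θ.Holds W (push m (push x v))
  delta_comprehension : ∀ (θ η : BddFormula) (v : ℕ → M) (W : ℕ → Set M), (∀ i, W i ∈ S) →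
    (∀ x, (∃ m, θ.Holds W (push m (push x v))) ↔ ∀ m, η.Holds W (push m (push x v))) →
    {x | ∃ m, θ.Holds W (push m (push x v))} ∈ S

section Internal

/-! All quantifiers in the following definitions range over `M`, over the sets in `S`, and over the
functions `M → M` whose graph is in `S`: the definitions are formulas of second-order arithmetic,
read in `(M, S)`. -/

variable {M : Type u} [Zero M] [One M] [Add M] [Mul M] [LT M]

/-- The ordered pair of two numbers, coded as a number. -/
def pair (x y : M) : M := (x + y) * (x + y) + x

/-- `f` is a function of the model: its graph, as a set of coded pairs, is in `S`. -/
def IsFunctionOf (S : Set (Set M)) (f : M → M) : Prop :=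
  {z | ∃ x, z = pair x (f x)} ∈ S

/-- `x ≤ y`. -/
def Le (x y : M) : Prop := x < y ∨ x = y

/-- `p = b ^ n`, by primitive recursion. -/
def IsPow (S : Set (Set M)) (b n p : M) : Prop :=
  ∃ e : M → M, IsFunctionOf S e ∧ e 0 = 1 ∧ (∀ i, e (i + 1) = e i * b) ∧ e n = p

/-- `s` is the result of replacing the base `b` by `c` everywhere in the complete
`b`-representation of `m`, where `2 ≤ b ≤ c`: if `h` denotes this operation, then `h 0 = 0`, and
`h (b ^ n * k + r) = c ^ h n * k + h r` for `0 < k < b` and `r < b ^ n`. -/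
def IsBaseChange (S : Set (Set M)) (b c m s : M) : Prop :=
  ∃ h : M → M, IsFunctionOf S h ∧ h 0 = 0 ∧
    (∀ n k r p, IsPow S b n p → 0 < k → k < b → r < p →
      ∃ q, IsPow S c (h n) q ∧ h (p * k + r) = q * k + h r) ∧
    h m = s

/-- `y` is the predecessor of `x`, where the predecessor of `0` is `0`. -/
def IsPred (x y : M) : Prop := (x = 0 ∧ y = 0) ∨ x = y + 1

/-- `g` is a Goodstein sequence for the base function `f`, with starting point `g 0`. -/
def IsGoodsteinSeq (S : Set (Set M)) (f g : M → M) : Prop :=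
  ∀ i, ∃ s, IsBaseChange S (f i) (f (i + 1)) (g i) s ∧ IsPred s (g (i + 1))

/-- Every Goodstein sequence, for every non-decreasing `f` with `f 0 ≥ 2`, terminates. -/
def GoodsteinTermination (S : Set (Set M)) : Prop :=
  ∀ f : M → M, IsFunctionOf S f → (∀ i j, Le i j → Le (f i) (f j)) → Le (1 + 1) (f 0) →
    ∀ g : M → M, IsFunctionOf S g → IsGoodsteinSeq S f g →
      ∃ k, ∀ i, Le k i → g i = 0

/-- The code of the term `ω ^ e * k + a` for codes `e` and `a`. The number `0` codes the empty sum,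
so `ω ^ e₁ * k₁ + ⋯ + ω ^ eₙ * kₙ` has the code `oadd e₁ k₁ (⋯ (oadd eₙ kₙ 0) ⋯)`. -/
def oadd (e k a : M) : M := pair e (pair k a) + 1

/-- `L` is the order on codes: sums are compared lexicographically from the left, at each place
first the exponents and then the coefficients, and a proper initial part of a sum is smaller than
the sum. -/
def IsOrdLtSet (L : Set M) : Prop :=
  ∀ x y, pair x y ∈ L ↔
    (x = 0 ∧ y ≠ 0) ∨
    ∃ e k a e' k' a', x = oadd e k a ∧ y = oadd e' k' a' ∧
      (pair e e' ∈ L ∨ (e = e' ∧ (k < k' ∨ (k = k' ∧ pair a a' ∈ L))))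

/-- The order on codes. -/
def OrdLt (S : Set (Set M)) (x y : M) : Prop :=
  ∃ L ∈ S, IsOrdLtSet L ∧ pair x y ∈ L

/-- `C` is the set of the codes of complete Cantor normal forms: all exponents are again complete
Cantor normal forms, the exponents of a sum decrease strictly, and the coefficients are positive. -/
def IsCNFSet (S : Set (Set M)) (C : Set M) : Prop :=
  ∀ x, x ∈ C ↔
    x = 0 ∨
    ∃ e k a, x = oadd e k a ∧ e ∈ C ∧ 0 < k ∧ a ∈ C ∧
      (a = 0 ∨ ∃ e' k' a', a = oadd e' k' a' ∧ OrdLt S e' e)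

/-- `x` codes an ordinal below `ε₀`, that is a complete Cantor normal form. -/
def IsCNF (S : Set (Set M)) (x : M) : Prop :=
  ∃ C ∈ S, IsCNFSet S C ∧ x ∈ C

/-- There is no infinite descending sequence of ordinals below `ε₀`. -/
def NoDescendingSeq (S : Set (Set M)) : Prop :=
  ¬ ∃ α : M → M, IsFunctionOf S α ∧ (∀ i, IsCNF S (α i)) ∧ ∀ i, OrdLt S (α (i + 1)) (α i)

end Internal

end SecondOrderArith

/-!
In a model `(M, S)` of `RCA₀`, replacing the base `b` by `ω` in the complete `b`-representation of
a number yields a Cantor normal form with coefficients smaller than `b` (`toOrd`), and replacing `ω`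
by `b` in such a normal form leads back (`evalOrd`, `toOrd_evalOrd`). Both operations preserve the
order (`toOrd_lt_toOrd`, `evalOrd_lt_evalOrd`), and the base change from `b` to `c` is `toOrd` for
`b` followed by `evalOrd` for `c` (`isBaseChange_iff`).

If a Goodstein sequence `m` for the bases `f` never reaches `0`, then the codes `toOrd (f i) (m i)`
form a descending sequence: a base change does not affect them, and subtracting `1` makes them
smaller (`NoDescendingSeq.goodsteinTermination`). If, conversely, `α` is a descending sequence, let
`f` be non-decreasing such that `f i` exceeds the coefficients in `α i`, and let `m` be the
Goodstein sequence for `f` that starts with `evalOrd (f 0) (α 0)`. Inductively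
`evalOrd (f i) (α i) ≤ m i`: the base change turns this into
`evalOrd (f (i + 1)) (α i) ≤ m (i + 1) + 1`, and `evalOrd (f (i + 1)) (α (i + 1))` is smaller than
the left side. As no `α i` is zero, `m` does not terminate (`GoodsteinTermination.noDescendingSeq`).

All of this takes place in the model. The predicate `Recursive S` expresses that a function belongs
to the model, and a predicate is treated as a function to `Prop`. The set-theoretic axioms enter
through closure properties of `Recursive` and through induction. Functions are defined by
course-of-values recursion (`exists_course_of_values_recursion`), for which finite sequences are
coded by numbers with Gödel's `β` function (`exists_residues`, `exists_entry`).
-/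

set_option linter.unusedSectionVars false

namespace SecondOrderArith

/-! ### Arithmetic in a model -/

section Arithmetic

variable {M : Type u} [Zero M] [One M] [Add M] [Mul M] [LT M] {S : Set (Set M)}

/-- Induction for a predicate that is defined by a bounded formula `θ`, in which the variable `1` is
the induction variable and the variable `0`, quantified in `sigma_induction`, is idle. -/
theorem ModelsRCA0.bounded_induction (hS : ModelsRCA0 S) {W : ℕ → Set M} (hW : ∀ i, W i ∈ S)
    (θ : BddFormula) (v : ℕ → M) (P : M → Prop)
    (hP : ∀ m x, θ.Holds W (push m (push x v)) ↔ P x) (h0 : P 0)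
    (h1 : ∀ x, P x → P (x + 1)) (x : M) : P x := by
  have := hS.sigma_induction θ v W hW ⟨0, (hP _ _).2 h0⟩
    (fun x ⟨m, hm⟩ => ⟨0, (hP _ _).2 (h1 x ((hP _ _).1 hm))⟩) x
  obtain ⟨m, hm⟩ := this
  exact (hP _ _).1 hm

/-- The assignment of the values `a`, `b` to the first two variables. -/
def assign₂ (a b : M) : ℕ → M := push a (push b fun _ => 0)

namespace ModelsRCA0

open NumTerm BddFormula

theorem zero_add (hS : ModelsRCA0 S) (hne : S.Nonempty) (x : M) : 0 + x = x := by
  obtain ⟨A, hA⟩ := hne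
  refine hS.bounded_induction (W := fun _ => A) (fun _ => hA)
    (eq (.add .zero (.var 1)) (.var 1)) (fun _ => 0) (fun x => 0 + x = x)
    (fun _ _ => Iff.rfl) (hS.add_zero 0) (fun x hx => ?_) x
  rw [hS.add_succ, hx]

theorem succ_add (hS : ModelsRCA0 S) (hne : S.Nonempty) (x y : M) : (x + 1) + y = (x + y) + 1 := by
  obtain ⟨A, hA⟩ := hne
  refine hS.bounded_induction (W := fun _ => A) (fun _ => hA)
    (eq (.add (.add (.var 2) .one) (.var 1)) (.add (.add (.var 2) (.var 1)) .one)) (fun _ => x)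
    (fun y => (x + 1) + y = (x + y) + 1)
    (fun _ _ => Iff.rfl) ?_ (fun y hy => ?_) y
  · rw [hS.add_zero, hS.add_zero]
  · rw [hS.add_succ, hy, hS.add_succ]

theorem add_comm (hS : ModelsRCA0 S) (hne : S.Nonempty) (x y : M) : x + y = y + x := by
  have h0 := hS.zero_add hne
  have h1 := hS.succ_add hne
  obtain ⟨A, hA⟩ := hne
  refine hS.bounded_induction (W := fun _ => A) (fun _ => hA)
    (eq (.add (.var 2) (.var 1)) (.add (.var 1) (.var 2))) (fun _ => x) (fun y => x + y = y + x)
    (fun _ _ => Iff.rfl) ?_ (fun y hy => ?_) y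
  · rw [hS.add_zero, h0]
  · rw [hS.add_succ, hy, h1]

theorem add_assoc (hS : ModelsRCA0 S) (hne : S.Nonempty) (x y z : M) :
    x + y + z = x + (y + z) := by
  obtain ⟨A, hA⟩ := hne
  refine hS.bounded_induction (W := fun _ => A) (fun _ => hA)
    (eq (.add (.add (.var 2) (.var 3)) (.var 1)) (.add (.var 2) (.add (.var 3) (.var 1))))
    (assign₂ x y) (fun z => x + y + z = x + (y + z)) (fun _ _ => Iff.rfl) ?_ (fun z hz => ?_) z
  · rw [hS.add_zero, hS.add_zero]
  · rw [hS.add_succ, hz, hS.add_succ, hS.add_succ]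

theorem add_right_cancel (hS : ModelsRCA0 S) (hne : S.Nonempty) (x y z : M)
    (h : x + z = y + z) : x = y := by
  obtain ⟨A, hA⟩ := hne
  refine hS.bounded_induction (W := fun _ => A) (fun _ => hA)
    (.or (.not (eq (.add (.var 2) (.var 1)) (.add (.var 3) (.var 1)))) (eq (.var 2) (.var 3)))
    (assign₂ x y) (fun z => ¬ (x + z = y + z) ∨ x = y) (fun _ _ => Iff.rfl) ?_
      (fun z hz => ?_) z |>.resolve_left (not_not.2 h)
  · rw [hS.add_zero, hS.add_zero]
    exact (em _).symm
  · refine hz.imp_left fun hz h => hz (hS.succ_inj _ _ ?_)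
    rw [← hS.add_succ, ← hS.add_succ, h]

theorem zero_mul (hS : ModelsRCA0 S) (hne : S.Nonempty) (x : M) : 0 * x = 0 := by
  obtain ⟨A, hA⟩ := hne
  refine hS.bounded_induction (W := fun _ => A) (fun _ => hA)
    (eq (.mul .zero (.var 1)) .zero) (fun _ => 0) (fun x => 0 * x = 0)
    (fun _ _ => Iff.rfl) (hS.mul_zero 0) (fun x hx => ?_) x
  rw [hS.mul_succ, hx, hS.add_zero]

theorem succ_mul (hS : ModelsRCA0 S) (hne : S.Nonempty) (x y : M) : (x + 1) * y = x * y + y := by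
  have ha := hS.add_assoc hne
  have hc := hS.add_comm hne
  obtain ⟨A, hA⟩ := hne
  refine hS.bounded_induction (W := fun _ => A) (fun _ => hA)
    (eq (.mul (.add (.var 2) .one) (.var 1)) (.add (.mul (.var 2) (.var 1)) (.var 1)))
    (fun _ => x) (fun y => (x + 1) * y = x * y + y)
    (fun _ _ => Iff.rfl) ?_ (fun y hy => ?_) y
  · rw [hS.mul_zero, hS.mul_zero, hS.add_zero]
  · rw [hS.mul_succ, hy, hS.mul_succ, ha, ha, ← ha y x 1, ← ha x y 1, hc y x]

theorem mul_comm (hS : ModelsRCA0 S) (hne : S.Nonempty) (x y : M) : x * y = y * x := by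
  have h0 := hS.zero_mul hne
  have h1 := hS.succ_mul hne
  obtain ⟨A, hA⟩ := hne
  refine hS.bounded_induction (W := fun _ => A) (fun _ => hA)
    (eq (.mul (.var 2) (.var 1)) (.mul (.var 1) (.var 2))) (fun _ => x) (fun y => x * y = y * x)
    (fun _ _ => Iff.rfl) ?_ (fun y hy => ?_) y
  · rw [hS.mul_zero, h0]
  · rw [hS.mul_succ, hy, h1]

theorem mul_add (hS : ModelsRCA0 S) (hne : S.Nonempty) (x y z : M) :
    x * (y + z) = x * y + x * z := by
  have ha := hS.add_assoc hne
  obtain ⟨A, hA⟩ := hne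
  refine hS.bounded_induction (W := fun _ => A) (fun _ => hA)
    (eq (.mul (.var 2) (.add (.var 3) (.var 1)))
      (.add (.mul (.var 2) (.var 3)) (.mul (.var 2) (.var 1))))
    (assign₂ x y) (fun z => x * (y + z) = x * y + x * z) (fun _ _ => Iff.rfl) ?_
    (fun z hz => ?_) z
  · rw [hS.add_zero, hS.mul_zero, hS.add_zero]
  · rw [hS.add_succ, hS.mul_succ, hz, hS.mul_succ, ha]

theorem mul_assoc (hS : ModelsRCA0 S) (hne : S.Nonempty) (x y z : M) :
    x * y * z = x * (y * z) := by
  have ha := hS.mul_add hne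
  obtain ⟨A, hA⟩ := hne
  refine hS.bounded_induction (W := fun _ => A) (fun _ => hA)
    (eq (.mul (.mul (.var 2) (.var 3)) (.var 1)) (.mul (.var 2) (.mul (.var 3) (.var 1))))
    (assign₂ x y) (fun z => x * y * z = x * (y * z)) (fun _ _ => Iff.rfl) ?_ (fun z hz => ?_) z
  · rw [hS.mul_zero, hS.mul_zero, hS.mul_zero]
  · rw [hS.mul_succ, hz, hS.mul_succ, ha]

theorem mul_one (hS : ModelsRCA0 S) (hne : S.Nonempty) (x : M) : x * 1 = x := by
  rw [← hS.zero_add hne 1, hS.mul_succ, hS.mul_zero, hS.zero_add hne]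

theorem lt_add_succ (hS : ModelsRCA0 S) (hne : S.Nonempty) (x z : M) : x < x + (z + 1) := by
  obtain ⟨A, hA⟩ := id hne
  refine hS.bounded_induction (W := fun _ => A) (fun _ => hA)
    (.lt (.var 2) (.add (.var 2) (.add (.var 1) .one))) (fun _ => x) (fun z => x < x + (z + 1))
    (fun _ _ => Iff.rfl) ?_ (fun z hz => ?_) z
  · rw [hS.zero_add hne, hS.lt_succ]
    exact Or.inr rfl
  · rw [hS.add_succ, hS.lt_succ]
    exact Or.inl hz

theorem exists_add_succ_of_lt (hS : ModelsRCA0 S) (hne : S.Nonempty) {x y : M} (h : x < y) :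
    ∃ z, y = x + (z + 1) := by
  obtain ⟨A, hA⟩ := id hne
  have key : ∀ y : M, (∃ z, ¬ x < y ∨ y = x + (z + 1)) →
      ∃ z, ¬ x < y + 1 ∨ y + 1 = x + (z + 1) := by
    rintro y ⟨z, hz⟩
    rw [hS.lt_succ]
    by_cases hxy : x = y
    · exact ⟨0, Or.inr (by rw [hxy, hS.zero_add hne])⟩
    · rcases hz with hz | hz
      · exact ⟨0, Or.inl (by tauto)⟩
      · exact ⟨z + 1, Or.inr (by rw [hS.add_succ x (z + 1), ← hz])⟩
  obtain ⟨z, hz⟩ := hS.sigma_induction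
    (.or (.not (.lt (.var 2) (.var 1))) (.eq (.var 1) (.add (.var 2) (.add (.var 0) .one))))
    (fun _ => x) (fun _ => A) (fun _ => hA)
    ⟨0, Or.inl (hS.not_lt_zero _)⟩ key y
  exact ⟨z, hz.resolve_left (not_not.2 h)⟩

theorem lt_iff (hS : ModelsRCA0 S) (hne : S.Nonempty) {x y : M} :
    x < y ↔ ∃ z, y = x + (z + 1) :=
  ⟨hS.exists_add_succ_of_lt hne, by rintro ⟨z, rfl⟩; exact hS.lt_add_succ hne x z⟩

theorem eq_zero_or_succ (hS : ModelsRCA0 S) (hne : S.Nonempty) (x : M) :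
    x = 0 ∨ ∃ y, x = y + 1 := by
  obtain ⟨A, hA⟩ := id hne
  obtain ⟨z, hz⟩ := hS.sigma_induction
    (.or (.eq (.var 1) .zero) (.eq (.var 1) (.add (.var 0) .one)))
    (fun _ => x) (fun _ => A) (fun _ => hA)
    ⟨0, Or.inl rfl⟩ (fun y _ => ⟨y, Or.inr rfl⟩) x
  exact Or.imp id (fun h => ⟨z, h⟩) hz

theorem lt_trichotomy (hS : ModelsRCA0 S) (hne : S.Nonempty) (x y : M) :
    x < y ∨ x = y ∨ y < x := by
  obtain ⟨A, hA⟩ := id hne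
  refine hS.bounded_induction (W := fun _ => A) (fun _ => hA)
    (.or (.lt (.var 2) (.var 1)) (.or (.eq (.var 2) (.var 1)) (.lt (.var 1) (.var 2))))
    (fun _ => x) (fun y => x < y ∨ x = y ∨ y < x)
    (fun _ _ => Iff.rfl) ?_ (fun y hy => ?_) y
  · rcases hS.eq_zero_or_succ hne x with rfl | ⟨z, rfl⟩
    · exact Or.inr (Or.inl rfl)
    · refine Or.inr (Or.inr ((hS.lt_iff hne).2 ⟨z, ?_⟩))
      rw [hS.zero_add hne]
  · rcases hy with hy | hy | hy
    · exact Or.inl ((hS.lt_succ _ _).2 (Or.inl hy))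
    · exact Or.inl ((hS.lt_succ _ _).2 (Or.inr hy))
    · obtain ⟨z, rfl⟩ := hS.exists_add_succ_of_lt hne hy
      rcases hS.eq_zero_or_succ hne z with rfl | ⟨w, rfl⟩
      · exact Or.inr (Or.inl (by rw [hS.zero_add hne]))
      · refine Or.inr (Or.inr ((hS.lt_iff hne).2 ⟨w, ?_⟩))
        rw [hS.succ_add hne y, hS.add_succ y (w + 1)]

theorem lt_irrefl (hS : ModelsRCA0 S) (hne : S.Nonempty) (x : M) : ¬ x < x := by
  rw [hS.lt_iff hne]
  rintro ⟨z, hz⟩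
  refine hS.succ_ne_zero z (hS.add_right_cancel hne _ _ x ?_)
  rw [hS.zero_add hne, hS.add_comm hne, ← hz]

theorem lt_trans (hS : ModelsRCA0 S) (hne : S.Nonempty) {x y z : M} (h : x < y) (h' : y < z) :
    x < z := by
  rw [hS.lt_iff hne] at *
  obtain ⟨a, rfl⟩ := h
  obtain ⟨b, rfl⟩ := h'
  exact ⟨(a + 1) + b, by rw [hS.add_assoc hne, hS.add_succ (a + 1)]⟩

/-- The numbers of a model of `RCA₀` form a commutative semiring. -/
@[reducible]
def commSemiring (hS : ModelsRCA0 S) (hne : S.Nonempty) : CommSemiring M where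
  add_assoc := hS.add_assoc hne
  zero_add := hS.zero_add hne
  add_zero := hS.add_zero
  add_comm := hS.add_comm hne
  left_distrib := hS.mul_add hne
  right_distrib x y z := by
    rw [hS.mul_comm hne, hS.mul_add hne, hS.mul_comm hne z, hS.mul_comm hne z]
  zero_mul := hS.zero_mul hne
  mul_zero := hS.mul_zero
  mul_assoc := hS.mul_assoc hne
  one_mul x := by rw [hS.mul_comm hne, hS.mul_one hne]
  mul_one := hS.mul_one hne
  mul_comm := hS.mul_comm hne
  nsmul := nsmulRec

open Classical in
/-- The numbers of a model of `RCA₀` are linearly ordered. -/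
@[reducible]
noncomputable def linearOrder (hS : ModelsRCA0 S) (hne : S.Nonempty) : LinearOrder M where
  le := Le
  le_refl _ := Or.inr rfl
  le_trans x y z h h' := by
    rcases h with h | rfl
    · rcases h' with h' | rfl
      · exact Or.inl (hS.lt_trans hne h h')
      · exact Or.inl h
    · exact h'
  lt_iff_le_not_ge x y := by
    refine ⟨fun h => ⟨Or.inl h, ?_⟩, ?_⟩
    · rintro (h' | rfl)
      · exact hS.lt_irrefl hne _ (hS.lt_trans hne h h')
      · exact hS.lt_irrefl hne _ h
    · rintro ⟨h | rfl, h'⟩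
      · exact h
      · exact absurd (Or.inr rfl) h'
  le_antisymm x y h h' := by
    rcases h with h | rfl
    · rcases h' with h' | rfl
      · exact absurd (hS.lt_trans hne h h') (hS.lt_irrefl hne _)
      · rfl
    · rfl
  le_total x y := by
    rcases hS.lt_trichotomy hne x y with h | h | h
    · exact Or.inl (Or.inl h)
    · exact Or.inl (Or.inr h)
    · exact Or.inr (Or.inl h)
  toDecidableLE := fun _ _ => Classical.propDecidable _

end ModelsRCA0

end Arithmetic

/-- `S` is nonempty and, together with the ordered semiring `M`, a model of `RCA₀`. For empty `S`
there is no assignment of the set variables, and induction and comprehension are void. -/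
class IsModel {M : Type u} [CommSemiring M] [LinearOrder M] (S : Set (Set M)) : Prop where
  models : ModelsRCA0 S
  nonempty : S.Nonempty

section Order

variable {M : Type u} [CommSemiring M] [LinearOrder M]

theorem ModelsRCA0.isStrictOrderedRing {S : Set (Set M)} (hS : ModelsRCA0 S)
    (hne : S.Nonempty) : IsStrictOrderedRing M := by
  have key : ∀ a b c : M, a < b → 0 < c → a * c < b * c := by
    intro a b c hab hc
    rw [hS.lt_iff hne] at *
    obtain ⟨z, rfl⟩ := hab
    obtain ⟨w, rfl⟩ := hc
    exact ⟨(z + 1) * w + z, by ring⟩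
  have hadd : ∀ a b c : M, a < b → a + c < b + c := by
    intro a b c hab
    rw [hS.lt_iff hne] at *
    obtain ⟨z, rfl⟩ := hab
    exact ⟨z, by ring⟩
  have h01 : (0 : M) < 1 := (hS.lt_iff hne).2 ⟨0, by ring⟩
  have hle : ∀ a b c : M, a ≤ b → a + c ≤ b + c := by
    intro a b c hab
    rcases hab.lt_or_eq with h | rfl
    · exact (hadd a b c h).le
    · exact le_rfl
  exact
    { add_le_add_left := fun a b hab c => hle a b c hab
      le_of_add_le_add_left := fun a b c h => by
        by_contra hcon
        have := hadd c b a (not_le.1 hcon)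
        rw [_root_.add_comm c, _root_.add_comm b] at this
        exact absurd h (not_le.2 this)
      zero_le_one := h01.le
      exists_pair_ne := ⟨0, 1, h01.ne⟩
      mul_lt_mul_of_pos_left := fun c hc a b hab => by
        have := key a b c hab hc
        rwa [_root_.mul_comm a, _root_.mul_comm b] at this
      mul_lt_mul_of_pos_right := fun c hc a b hab => key a b c hab hc }

theorem ModelsRCA0.canonicallyOrderedAdd {S : Set (Set M)} (hS : ModelsRCA0 S)
    (hne : S.Nonempty) : CanonicallyOrderedAdd M := by
  have h : ∀ a b : M, a ≤ a + b := by
    intro a b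
    rcases hS.eq_zero_or_succ hne b with rfl | ⟨c, rfl⟩
    · rw [_root_.add_zero]
    · exact (hS.lt_add_succ hne a c).le
  exact
    { exists_add_of_le := fun {a b} hab => by
        rcases hab.lt_or_eq with h | rfl
        · obtain ⟨z, hz⟩ := hS.exists_add_succ_of_lt hne h
          exact ⟨_, hz⟩
        · exact ⟨0, by simp⟩
      le_self_add := h
      le_add_self := fun a b => (h a b).trans_eq (_root_.add_comm _ _) }

end Order

/-! ### Definability in a model -/

section Definability

variable {M : Type u} [CommSemiring M] [LinearOrder M] [IsStrictOrderedRing M]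
  [CanonicallyOrderedAdd M]

theorem lt_add_one_iff (S : Set (Set M)) [hS : IsModel S] {x y : M} : x < y + 1 ↔ x ≤ y := by
  rw [hS.models.lt_succ, le_iff_lt_or_eq]

theorem add_one_le_iff (S : Set (Set M)) [hS : IsModel S] {x y : M} : x + 1 ≤ y ↔ x < y := by
  rw [← not_lt, lt_add_one_iff S, not_le]

theorem le_mul_self (S : Set (Set M)) [IsModel S] (x : M) : x ≤ x * x := by
  rcases (zero_le (a := x)).eq_or_lt with rfl | h
  · simp
  · have : (1 : M) ≤ x := by simpa using (add_one_le_iff S).2 h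
    exact le_mul_of_one_le_left zero_le this

theorem left_le_pair (x y : M) : x ≤ pair x y := le_add_self

theorem right_le_pair (S : Set (Set M)) [IsModel S] (x y : M) : y ≤ pair x y :=
  (le_add_self.trans (le_mul_self S (x + y))).trans le_self_add

/-- The code of a pair lies between the square of the sum of its components and the next square. -/
theorem pair_lt_of_add_lt (S : Set (Set M)) [IsModel S] {x y x' y' : M} (h : x + y < x' + y') :
    pair x y < pair x' y' := by
  have h1 : x + y + 1 ≤ x' + y' := (add_one_le_iff S).2 h
  calc pair x y < (x + y) * (x + y) + (x + y) + ((x + y) + 1) := by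
        unfold pair
        refine lt_of_le_of_lt ?_ (lt_add_of_pos_right _ (by positivity))
        gcongr
        exact le_self_add
    _ = (x + y + 1) * (x + y + 1) := by ring
    _ ≤ (x' + y') * (x' + y') := by gcongr
    _ ≤ pair x' y' := le_self_add

theorem pair_inj (S : Set (Set M)) [IsModel S] {x y x' y' : M} :
    pair x y = pair x' y' ↔ x = x' ∧ y = y' := by
  refine ⟨fun h => ?_, by rintro ⟨rfl, rfl⟩; rfl⟩
  have hs : x + y = x' + y' := by
    rcases lt_trichotomy (x + y) (x' + y') with h1 | h1 | h1
    · exact absurd h (pair_lt_of_add_lt S h1).ne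
    · exact h1
    · exact absurd h (pair_lt_of_add_lt S h1).ne'
  have hx : x = x' := by
    unfold pair at h
    rw [hs] at h
    exact add_left_cancel h
  subst hx
  exact ⟨rfl, add_left_cancel hs⟩

theorem pair_lt_pair (S : Set (Set M)) [IsModel S] {x y x' y' : M} (h : x < x') (h' : y < y') :
    pair x y < pair x' y' :=
  pair_lt_of_add_lt S (add_lt_add h h')

theorem push_mem {S : Set (Set M)} {A : Set M} {W : ℕ → Set M} (hA : A ∈ S)
    (hW : ∀ i, W i ∈ S) : ∀ i, push A W i ∈ S
  | 0 => hA
  | i + 1 => hW i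

/-- The term for the pair of two numbers. -/
def NumTerm.pair (s t : NumTerm) : NumTerm := .add (.mul (.add s t) (.add s t)) s

/-- The formula that says that the value of the variable `i` is a pair `(x, y)` with the property
`φ`. In `φ` the variables `0` and `1` stand for `y` and `x`; the others are shifted by `2`. Both
components of a pair are bounded by its code, so that bounded quantifiers suffice. -/
def BddFormula.exPair (i : ℕ) (φ : BddFormula) : BddFormula :=
  .exLt (.add (.var i) .one) (.exLt (.add (.var (i + 1)) .one)
    (.and (.eq (.var (i + 2)) (.pair (.var 1) (.var 0))) φ))

theorem BddFormula.holds_exPair (S : Set (Set M)) [IsModel S] {i : ℕ} {φ : BddFormula}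
    {W : ℕ → Set M} {v : ℕ → M} :
    (exPair i φ).Holds W v ↔
      ∃ x y, v i = SecondOrderArith.pair x y ∧ φ.Holds W (push y (push x v)) := by
  constructor
  · rintro ⟨x, -, y, -, h, hφ⟩
    exact ⟨x, y, h, hφ⟩
  · rintro ⟨x, y, h, hφ⟩
    refine ⟨x, ?_, y, ?_, h, hφ⟩
    · exact (lt_add_one_iff S).2 ((left_le_pair x y).trans_eq h.symm)
    · exact (lt_add_one_iff S).2 ((right_le_pair S x y).trans_eq h.symm)

variable {S : Set (Set M)} [hS : IsModel S]

/-- Comprehension for bounded formulas. The variable `0` of `θ` is idle: it is the one that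
`delta_comprehension` quantifies. -/
theorem setOf_mem_of_bounded {W : ℕ → Set M} (hW : ∀ i, W i ∈ S) (θ : BddFormula) (v : ℕ → M)
    {P : M → Prop} (hP : ∀ m x, θ.Holds W (push m (push x v)) ↔ P x) : {x | P x} ∈ S := by
  have := hS.models.delta_comprehension θ θ v W hW (by simp [hP])
  simpa [hP] using this

variable (S) in
/-- A coding of the elements of `α` as numbers, the range of which is a set of the model. -/
class Coded (α : Type*) where
  /-- The code of an element. -/
  enc : α → M
  enc_injective : Function.Injective enc
  range_mem : Set.range enc ∈ S

variable (S) in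
/-- The code of an element of a coded type. -/
abbrev enc {α : Type*} [Coded S α] (a : α) : M := Coded.enc S a

theorem enc_inj {α : Type*} [Coded S α] {a b : α} : enc S a = enc S b ↔ a = b :=
  Coded.enc_injective.eq_iff

theorem univ_mem : Set.univ ∈ S := by
  obtain ⟨A, hA⟩ := hS.nonempty
  exact setOf_mem_of_bounded (W := fun _ => A) (fun _ => hA) (.eq .zero .zero) (fun _ => 0)
    (P := fun _ => True) (fun m x => iff_true_intro rfl)

instance : Coded S M where
  enc := id
  enc_injective := Function.injective_id
  range_mem := by
    rw [Set.range_id]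
    exact univ_mem

theorem enc_self (x : M) : enc S x = x := rfl

instance {α β : Type*} [Coded S α] [Coded S β] : Coded S (α × β) where
  enc p := pair (enc S p.1) (enc S p.2)
  enc_injective := by
    rintro ⟨a, b⟩ ⟨a', b'⟩ h
    have := (pair_inj S).1 h
    rw [enc_inj, enc_inj] at this
    exact Prod.ext this.1 this.2
  range_mem := by
    refine setOf_mem_of_bounded (W := push (Set.range (enc S (α := α)))
      fun _ => Set.range (enc S (α := β))) (push_mem Coded.range_mem fun _ => Coded.range_mem)
      (.exPair 1 (.and (.mem (.var 1) 0) (.mem (.var 0) 1))) (fun _ => 0) ?_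
    intro m z
    rw [BddFormula.holds_exPair S]
    constructor
    · rintro ⟨_, _, hz, ⟨a, rfl⟩, b, rfl⟩
      exact ⟨(a, b), hz.symm⟩
    · rintro ⟨⟨a, b⟩, rfl⟩
      exact ⟨enc S a, enc S b, rfl, ⟨a, rfl⟩, b, rfl⟩

open Classical in
/-- Truth values are coded by `0` and `1`, so that predicates are a special kind of functions. -/
noncomputable instance : Coded S Prop where
  enc p := if p then 1 else 0
  enc_injective := by
    intro p q h
    by_cases hp : p <;> by_cases hq : q <;> simp_all
  range_mem := by
    refine setOf_mem_of_bounded (W := fun _ => Set.univ) (fun _ => univ_mem)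
      (.or (.eq (.var 1) .zero) (.eq (.var 1) .one)) (fun _ => 0) (fun m x => ?_)
    constructor
    · rintro (h | h)
      · exact ⟨False, (if_neg not_false).trans h.symm⟩
      · exact ⟨True, (if_pos trivial).trans h.symm⟩
    · rintro ⟨p, rfl⟩
      by_cases hp : p
      · exact Or.inr (if_pos hp)
      · exact Or.inl (if_neg hp)

theorem enc_of_true {p : Prop} (hp : p) : enc S p = 1 := if_pos hp
theorem enc_of_false {p : Prop} (hp : ¬ p) : enc S p = 0 := if_neg hp

variable {α β γ : Type*} [Coded S α] [Coded S β] [Coded S γ]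

variable (S) in
/-- `f` is a function of the model. For a function with truth values this means that it is a
decidable predicate, that is that the codes of the elements with this property form a set of the
model. -/
@[fun_prop]
def Recursive (f : α → β) : Prop := {z | ∃ a, z = pair (enc S a) (enc S (f a))} ∈ S

theorem recursive_iff_isFunctionOf {f : M → M} : Recursive S f ↔ IsFunctionOf S f := Iff.rfl

namespace Recursive

@[fun_prop]
theorem id : Recursive S (fun a : α => a) := by
  refine setOf_mem_of_bounded (W := fun _ => Set.range (enc S (α := α)))
    (fun _ => Coded.range_mem)
    (.exPair 1 (.and (.mem (.var 1) 0) (.eq (.var 0) (.var 1)))) (fun _ => 0) ?_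
  intro m z
  rw [BddFormula.holds_exPair S]
  constructor
  · rintro ⟨_, y, hz, ⟨a, rfl⟩, h⟩
    refine ⟨a, hz.trans ?_⟩
    rw [show y = enc S a from h]
  · rintro ⟨a, rfl⟩
    exact ⟨_, _, rfl, ⟨a, rfl⟩, rfl⟩

@[fun_prop]
theorem const (b : β) : Recursive S (fun _ : α => b) := by
  refine setOf_mem_of_bounded (W := fun _ => Set.range (enc S (α := α)))
    (fun _ => Coded.range_mem)
    (.exPair 1 (.and (.mem (.var 1) 0) (.eq (.var 0) (.var 4)))) (fun _ => enc S b) ?_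
  intro m z
  rw [BddFormula.holds_exPair S]
  constructor
  · rintro ⟨_, y, hz, ⟨a, rfl⟩, h⟩
    refine ⟨a, hz.trans ?_⟩
    rw [show y = enc S b from h]
  · rintro ⟨a, rfl⟩
    exact ⟨_, _, rfl, ⟨a, rfl⟩, rfl⟩

/-- Membership of a pair in the graph, if the second component is not known to be a code. -/
theorem mem_graph {f : α → β} {a : α} {y : M} :
    pair (enc S a) y ∈ {z | ∃ a, z = pair (enc S a) (enc S (f a))} ↔ y = enc S (f a) := by
  constructor
  · rintro ⟨b, hb⟩
    rw [pair_inj S, enc_inj] at hb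
    rw [hb.2, hb.1]
  · rintro rfl
    exact ⟨a, rfl⟩

/-- The composition has the `Σ⁰₁` definition that *some* value of `f` at `x` is mapped to `w`, and
the `Π⁰₁` definition that *every* such value is. -/
@[fun_prop]
theorem comp {g : β → γ} {f : α → β} (hg : Recursive S g) (hf : Recursive S f) :
    Recursive S (fun a => g (f a)) := by
  have := hS.models.delta_comprehension
    (.exPair 1 (.and (.mem (.var 1) 0)
      (.and (.mem (.pair (.var 1) (.var 2)) 1) (.mem (.pair (.var 2) (.var 0)) 2))))
    (.exPair 1 (.and (.mem (.var 1) 0)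
      (.or (.not (.mem (.pair (.var 1) (.var 2)) 1)) (.mem (.pair (.var 2) (.var 0)) 2))))
    (fun _ => 0) _ (push_mem (Coded.range_mem (α := α)) (push_mem hf fun _ => hg)) ?_
  · refine (congrArg (· ∈ S) (Set.ext fun z => ?_)).mp this
    rw [Set.mem_ofPred_eq, Set.mem_ofPred_eq]
    simp only [BddFormula.holds_exPair S]
    constructor
    · rintro ⟨y, _, w, hz, ⟨a, rfl⟩, h, h'⟩
      have hy : y = enc S (f a) := mem_graph.1 h
      subst hy
      exact ⟨a, hz.trans (congrArg _ (mem_graph.1 h'))⟩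
    · rintro ⟨a, rfl⟩
      exact ⟨enc S (f a), _, _, rfl, ⟨a, rfl⟩, ⟨a, rfl⟩, ⟨f a, rfl⟩⟩
  · intro z
    simp only [BddFormula.holds_exPair S]
    constructor
    · rintro ⟨y, _, w, hz, ⟨a, rfl⟩, h, h'⟩ m
      refine ⟨enc S a, w, hz, ⟨a, rfl⟩, ?_⟩
      by_cases hm : m = y
      · exact Or.inr (by rw [hm]; exact h')
      · refine Or.inl fun h0 => hm ?_
        exact (mem_graph.1 h0).trans (mem_graph.1 h).symm
    · intro h
      obtain ⟨_, _, hz, ⟨a, rfl⟩, -⟩ := h 0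
      obtain ⟨_, w, hz', ⟨b, rfl⟩, h'⟩ := h (enc S (f a))
      obtain rfl : b = a := enc_inj.1 ((pair_inj S).1 (hz'.symm.trans hz)).1
      refine ⟨enc S (f b), enc S b, w, hz', ⟨b, rfl⟩, ⟨b, rfl⟩, h'.resolve_left ?_⟩
      exact not_not.2 ⟨b, rfl⟩

@[fun_prop]
theorem prodMk {f : α → β} {g : α → γ} (hf : Recursive S f) (hg : Recursive S g) :
    Recursive S (fun a => (f a, g a)) := by
  refine setOf_mem_of_bounded
    (push_mem (Coded.range_mem (α := α)) (push_mem hf fun _ => hg))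
    (.exPair 1 (.and (.mem (.var 1) 0) (.exPair 0
      (.and (.mem (.pair (.var 3) (.var 1)) 1) (.mem (.pair (.var 3) (.var 0)) 2)))))
    (fun _ => 0) ?_
  intro m z
  simp only [BddFormula.holds_exPair S, BddFormula.Holds]
  constructor
  · rintro ⟨_, w, hz, ⟨a, rfl⟩, y, y', hw, h, h'⟩
    refine ⟨a, hz.trans (congrArg _ ?_)⟩
    rw [show y = _ from mem_graph.1 h, show y' = _ from mem_graph.1 h'] at hw
    exact hw
  · rintro ⟨a, rfl⟩
    exact ⟨_, _, rfl, ⟨a, rfl⟩, _, _, rfl, ⟨a, rfl⟩, ⟨a, rfl⟩⟩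

theorem _root_.SecondOrderArith.recursive_fst : Recursive S (Prod.fst : α × β → α) := by
  refine setOf_mem_of_bounded (push_mem (Coded.range_mem (α := α))
      fun _ => (Coded.range_mem (α := β)))
    (.exPair 1 (.exPair 1 (.and (.mem (.var 1) 0) (.and (.mem (.var 0) 1)
      (.eq (.var 1) (.var 2)))))) (fun _ => 0) ?_
  intro m z
  simp only [BddFormula.holds_exPair S, BddFormula.Holds]
  constructor
  · rintro ⟨x, w, hz, _, _, hx, ⟨a, rfl⟩, ⟨b, rfl⟩, h⟩
    refine ⟨(a, b), hz.trans (congrArg₂ _ hx ?_)⟩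
    exact Eq.symm h
  · rintro ⟨⟨a, b⟩, rfl⟩
    exact ⟨_, _, rfl, _, _, rfl, ⟨a, rfl⟩, ⟨b, rfl⟩, rfl⟩

theorem _root_.SecondOrderArith.recursive_snd : Recursive S (Prod.snd : α × β → β) := by
  refine setOf_mem_of_bounded (push_mem (Coded.range_mem (α := α))
      fun _ => (Coded.range_mem (α := β)))
    (.exPair 1 (.exPair 1 (.and (.mem (.var 1) 0) (.and (.mem (.var 0) 1)
      (.eq (.var 0) (.var 2)))))) (fun _ => 0) ?_
  intro m z
  simp only [BddFormula.holds_exPair S, BddFormula.Holds]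
  constructor
  · rintro ⟨x, w, hz, _, _, hx, ⟨a, rfl⟩, ⟨b, rfl⟩, h⟩
    refine ⟨(a, b), hz.trans (congrArg₂ _ hx ?_)⟩
    exact Eq.symm h
  · rintro ⟨⟨a, b⟩, rfl⟩
    exact ⟨_, _, rfl, _, _, rfl, ⟨a, rfl⟩, ⟨b, rfl⟩, rfl⟩

@[fun_prop]
theorem fst {f : α → β × γ} (hf : Recursive S f) : Recursive S (fun a => (f a).1) :=
  comp recursive_fst hf

@[fun_prop]
theorem snd {f : α → β × γ} (hf : Recursive S f) : Recursive S (fun a => (f a).2) :=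
  comp recursive_snd hf

/-- The code of an element, as a number, is a function of the model. -/
theorem enc_comp {f : α → β} (hf : Recursive S f) : Recursive S (fun a => enc S (f a)) := hf

@[fun_prop]
theorem add {f g : α → M} (hf : Recursive S f) (hg : Recursive S g) :
    Recursive S (fun a => f a + g a) := by
  refine comp (g := fun p : M × M => p.1 + p.2) ?_ (prodMk hf hg)
  refine setOf_mem_of_bounded (fun _ => univ_mem)
    (.exPair 1 (.exPair 1 (.eq (.add (.var 1) (.var 0)) (.var 2)))) (fun _ => 0) ?_
  intro m z
  simp only [BddFormula.holds_exPair S]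
  constructor
  · rintro ⟨x, w, hz, a, b, hx, h⟩
    exact ⟨(a, b), hz.trans (congrArg₂ _ hx (Eq.symm h))⟩
  · rintro ⟨⟨a, b⟩, rfl⟩
    exact ⟨_, _, rfl, _, _, rfl, rfl⟩

@[fun_prop]
theorem mul {f g : α → M} (hf : Recursive S f) (hg : Recursive S g) :
    Recursive S (fun a => f a * g a) := by
  refine comp (g := fun p : M × M => p.1 * p.2) ?_ (prodMk hf hg)
  refine setOf_mem_of_bounded (fun _ => univ_mem)
    (.exPair 1 (.exPair 1 (.eq (.mul (.var 1) (.var 0)) (.var 2)))) (fun _ => 0) ?_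
  intro m z
  simp only [BddFormula.holds_exPair S]
  constructor
  · rintro ⟨x, w, hz, a, b, hx, h⟩
    exact ⟨(a, b), hz.trans (congrArg₂ _ hx (Eq.symm h))⟩
  · rintro ⟨⟨a, b⟩, rfl⟩
    exact ⟨_, _, rfl, _, _, rfl, rfl⟩

@[fun_prop]
theorem pair {f g : α → M} (hf : Recursive S f) (hg : Recursive S g) :
    Recursive S (fun a => SecondOrderArith.pair (f a) (g a)) := by
  unfold SecondOrderArith.pair
  fun_prop

/-- The decidable predicates are those whose extension is a set of the model. -/
theorem _root_.SecondOrderArith.recursive_iff_setOf_mem {P : α → Prop} :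
    Recursive S P ↔ {z | ∃ a, z = enc S a ∧ P a} ∈ S := by
  constructor
  · intro h
    refine setOf_mem_of_bounded (fun _ => h) (.mem (.pair (.var 1) .one) 0) (fun _ => 0) ?_
    intro m z
    constructor
    · rintro ⟨a, ha⟩
      obtain ⟨h1, h2⟩ := (pair_inj S).1 ha
      refine ⟨a, h1, ?_⟩
      by_contra hP
      rw [enc_of_false hP] at h2
      exact one_ne_zero (α := M) h2
    · rintro ⟨a, rfl, ha⟩
      exact ⟨a, congrArg (SecondOrderArith.pair (enc S a)) (enc_of_true ha).symm⟩
  · intro h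
    refine setOf_mem_of_bounded (push_mem (Coded.range_mem (α := α)) fun _ => h)
      (.exPair 1 (.and (.mem (.var 1) 0)
        (.or (.and (.mem (.var 1) 1) (.eq (.var 0) .one))
          (.and (.not (.mem (.var 1) 1)) (.eq (.var 0) .zero))))) (fun _ => 0) ?_
    have hmem : ∀ a, enc S a ∈ {z | ∃ a, z = enc S a ∧ P a} ↔ P a := by
      intro a
      constructor
      · rintro ⟨b, hb, h⟩
        rwa [enc_inj.1 hb]
      · exact fun h => ⟨a, rfl, h⟩
    intro m z
    simp only [BddFormula.holds_exPair S]
    constructor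
    · rintro ⟨_, y, hz, ⟨a, rfl⟩, ⟨h1, h2⟩ | ⟨h1, h2⟩⟩
      · have hP : P a := (hmem a).1 h1
        exact ⟨a, hz.trans (congrArg _ (Eq.trans h2 (enc_of_true hP).symm))⟩
      · have hP : ¬ P a := fun h => h1 ((hmem a).2 h)
        exact ⟨a, hz.trans (congrArg _ (Eq.trans h2 (enc_of_false hP).symm))⟩
    · rintro ⟨a, rfl⟩
      refine ⟨_, _, rfl, ⟨a, rfl⟩, ?_⟩
      by_cases hP : P a
      · exact Or.inl ⟨(hmem a).2 hP, enc_of_true hP⟩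
      · exact Or.inr ⟨fun h => hP ((hmem a).1 h), enc_of_false hP⟩

theorem mem {A : Set M} (hA : A ∈ S) {f : α → M} (hf : Recursive S f) :
    Recursive S (fun a => f a ∈ A) := by
  refine comp (g := fun x : M => x ∈ A) (recursive_iff_setOf_mem.2 ?_) hf
  refine (congrArg (· ∈ S) (Set.ext fun z => ?_)).mp hA
  exact ⟨fun h => ⟨z, rfl, h⟩, by rintro ⟨_, rfl, h⟩; exact h⟩

theorem setOf_mem {P : M → Prop} (hP : Recursive S P) : {x | P x} ∈ S := by
  refine (congrArg (· ∈ S) (Set.ext fun z => ?_)).mp (recursive_iff_setOf_mem.1 hP)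
  exact ⟨by rintro ⟨_, rfl, h⟩; exact h, fun h => ⟨z, rfl, h⟩⟩

/-- A function is a function of the model if its graph is decidable in the model. -/
theorem of_graph {f : α → β} (h : Recursive S (fun p : α × β => p.2 = f p.1)) : Recursive S f := by
  refine (congrArg (· ∈ S) (Set.ext fun z => ?_)).mp (recursive_iff_setOf_mem.1 h)
  constructor
  · rintro ⟨⟨a, b⟩, rfl, h⟩
    obtain rfl : b = f a := h
    exact ⟨a, rfl⟩
  · rintro ⟨a, rfl⟩
    exact ⟨(a, f a), rfl, rfl⟩

@[fun_prop]
theorem not {P : α → Prop} (hP : Recursive S P) : Recursive S (fun a => ¬ P a) := by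
  refine recursive_iff_setOf_mem.2 (setOf_mem_of_bounded (push_mem (Coded.range_mem (α := α))
    fun _ => recursive_iff_setOf_mem.1 hP) (.and (.mem (.var 1) 0) (.not (.mem (.var 1) 1)))
    (fun _ => 0) ?_)
  intro m z
  constructor
  · rintro ⟨⟨a, rfl⟩, h⟩
    exact ⟨a, rfl, fun ha => h ⟨a, rfl, ha⟩⟩
  · rintro ⟨a, rfl, ha⟩
    refine ⟨⟨a, rfl⟩, ?_⟩
    rintro ⟨b, hb, h⟩
    rw [← enc_inj.1 hb] at h
    exact ha h

@[fun_prop]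
theorem and {P Q : α → Prop} (hP : Recursive S P) (hQ : Recursive S Q) :
    Recursive S (fun a => P a ∧ Q a) := by
  refine recursive_iff_setOf_mem.2 (setOf_mem_of_bounded (push_mem (recursive_iff_setOf_mem.1 hP)
    fun _ => recursive_iff_setOf_mem.1 hQ) (.and (.mem (.var 1) 0) (.mem (.var 1) 1))
    (fun _ => 0) ?_)
  intro m z
  constructor
  · rintro ⟨⟨a, ha, h⟩, b, hb, h'⟩
    refine ⟨a, ha, h, ?_⟩
    rwa [enc_inj.1 (ha.symm.trans hb)]
  · rintro ⟨a, rfl, h, h'⟩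
    exact ⟨⟨a, rfl, h⟩, a, rfl, h'⟩

@[fun_prop]
theorem or {P Q : α → Prop} (hP : Recursive S P) (hQ : Recursive S Q) :
    Recursive S (fun a => P a ∨ Q a) := by
  simp only [or_iff_not_and_not]
  fun_prop

theorem imp {P Q : α → Prop} (hP : Recursive S P) (hQ : Recursive S Q) :
    Recursive S (fun a => P a → Q a) := by
  simp only [imp_iff_not_or]
  fun_prop

@[fun_prop]
theorem iff {P Q : α → Prop} (hP : Recursive S P) (hQ : Recursive S Q) :
    Recursive S (fun a => P a ↔ Q a) := by
  simp only [iff_iff_and_or_not_and_not]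
  fun_prop

@[fun_prop]
theorem eq {f g : α → β} (hf : Recursive S f) (hg : Recursive S g) :
    Recursive S (fun a => f a = g a) := by
  have h : Recursive S (fun p : M × M => p.1 = p.2) := by
    refine recursive_iff_setOf_mem.2 (setOf_mem_of_bounded (fun _ => univ_mem)
      (.exPair 1 (.eq (.var 1) (.var 0))) (fun _ => 0) fun m z => ?_)
    rw [BddFormula.holds_exPair S]
    constructor
    · rintro ⟨x, y, hz, h⟩
      exact ⟨(x, y), hz, h⟩
    · rintro ⟨⟨x, y⟩, hz, h⟩
      exact ⟨x, y, hz, h⟩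
  have h' := comp h (prodMk (enc_comp hf) (enc_comp hg))
  simpa only [enc_inj] using h'

@[fun_prop]
theorem lt {f g : α → M} (hf : Recursive S f) (hg : Recursive S g) :
    Recursive S (fun a => f a < g a) := by
  refine comp (g := fun p : M × M => p.1 < p.2) ?_ (prodMk hf hg)
  refine recursive_iff_setOf_mem.2 (setOf_mem_of_bounded (fun _ => univ_mem)
    (.exPair 1 (.lt (.var 1) (.var 0))) (fun _ => 0) fun m z => ?_)
  rw [BddFormula.holds_exPair S]
  constructor
  · rintro ⟨x, y, hz, h⟩
    exact ⟨(x, y), hz, h⟩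
  · rintro ⟨⟨x, y⟩, hz, h⟩
    exact ⟨x, y, hz, h⟩

@[fun_prop]
theorem le {f g : α → M} (hf : Recursive S f) (hg : Recursive S g) :
    Recursive S (fun a => f a ≤ g a) := by
  simp only [← not_lt]
  fun_prop

@[fun_prop]
theorem ite {P : α → Prop} [∀ a, Decidable (P a)] {f g : α → β} (hP : Recursive S P)
    (hf : Recursive S f) (hg : Recursive S g) :
    Recursive S (fun a => if P a then f a else g a) := by
  refine of_graph ?_
  have : Recursive S (fun p : α × β => (P p.1 ∧ p.2 = f p.1) ∨ (¬ P p.1 ∧ p.2 = g p.1)) := by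
    fun_prop
  convert this using 2 with p
  by_cases h : P p.1 <;> simp [h]

/-- Bounded universal quantification. -/
theorem ball {P : α → M → Prop} {f : α → M} (hP : Recursive S (fun p : α × M => P p.1 p.2))
    (hf : Recursive S f) : Recursive S (fun a => ∀ i < f a, P a i) := by
  refine comp (g := fun p : α × M => ∀ i < p.2, P p.1 i) ?_ (prodMk id hf)
  refine recursive_iff_setOf_mem.2 (setOf_mem_of_bounded
    (push_mem (Coded.range_mem (α := α)) fun _ => recursive_iff_setOf_mem.1 hP)
    (.exPair 1 (.and (.mem (.var 1) 0) (.allLt (.var 0) (.mem (.pair (.var 2) (.var 0)) 1))))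
    (fun _ => 0) fun m z => ?_)
  rw [BddFormula.holds_exPair S]
  constructor
  · rintro ⟨_, y, hz, ⟨a, rfl⟩, h⟩
    refine ⟨(a, y), hz, fun i hi => ?_⟩
    obtain ⟨⟨b, j⟩, hb, h'⟩ := h i hi
    obtain ⟨h1, rfl⟩ : a = b ∧ i = j :=
      Prod.mk.inj ((enc_inj (S := S) (a := (a, i)) (b := (b, j))).1 hb)
    rwa [h1]
  · rintro ⟨⟨a, y⟩, rfl, h⟩
    exact ⟨_, _, rfl, ⟨a, rfl⟩, fun i hi => ⟨(a, i), rfl, h i hi⟩⟩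

/-- Bounded existential quantification. -/
theorem bex {P : α → M → Prop} {f : α → M} (hP : Recursive S (fun p : α × M => P p.1 p.2))
    (hf : Recursive S f) : Recursive S (fun a => ∃ i < f a, P a i) := by
  have := (ball (P := fun a i => ¬ P a i) (hP.not) hf).not
  simpa using this

end Recursive

/-! ### Induction and unbounded search -/

/-- Induction for recursively enumerable predicates. -/
theorem sigma_induction {P : M → β → Prop} (hP : Recursive S (fun p : M × β => P p.1 p.2))
    (h0 : ∃ b, P 0 b) (h1 : ∀ x, (∃ b, P x b) → ∃ b, P (x + 1) b) (x : M) : ∃ b, P x b := by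
  rw [recursive_iff_setOf_mem] at hP
  have mem_iff : ∀ x m : M, SecondOrderArith.pair x m ∈
      {z | ∃ p : M × β, z = enc S p ∧ P p.1 p.2} ↔ ∃ b, m = enc S b ∧ P x b := by
    intro x m
    constructor
    · rintro ⟨p, hp, h⟩
      obtain ⟨hx, hm⟩ := (pair_inj S).1 hp
      rw [enc_self] at hx
      exact ⟨p.2, hm, by rwa [hx]⟩
    · rintro ⟨b, rfl, h⟩
      exact ⟨(x, b), rfl, h⟩
  obtain ⟨b, hb⟩ := h0
  obtain ⟨m, hm⟩ := hS.models.sigma_induction (.mem (.pair (.var 1) (.var 0)) 0) (fun _ => 0) _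
    (fun _ => hP) ⟨enc S b, (mem_iff _ _).2 ⟨b, rfl, hb⟩⟩ (by
      rintro x ⟨m, hm⟩
      obtain ⟨b, -, hb⟩ := (mem_iff _ _).1 hm
      obtain ⟨n, hn⟩ := h1 x ⟨b, hb⟩
      exact ⟨enc S n, (mem_iff _ _).2 ⟨n, rfl, hn⟩⟩) x
  obtain ⟨b, -, hb⟩ := (mem_iff _ _).1 hm
  exact ⟨b, hb⟩

/-- Induction for decidable predicates. -/
theorem Recursive.induction {P : M → Prop} (hP : Recursive S P) (h0 : P 0)
    (h1 : ∀ x, P x → P (x + 1)) (x : M) : P x := by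
  obtain ⟨-, h⟩ := sigma_induction (S := S) (β := M) (P := fun x _ => P x) (by fun_prop) ⟨0, h0⟩
    (fun x ⟨_, h⟩ => ⟨0, h1 x h⟩) x
  exact h

theorem Recursive.strong_induction {P : M → Prop} (hP : Recursive S P)
    (h : ∀ x, (∀ y < x, P y) → P x) (x : M) : P x := by
  have hB : Recursive S (fun x => ∀ y < x, P y) :=
    ball (α := M) (P := fun _ y => P y) (by fun_prop) id
  refine h x (hB.induction ?_ ?_ x)
  · exact fun y hy => absurd hy not_lt_zero
  · intro x hx y hy
    rcases ((lt_add_one_iff S).1 hy).lt_or_eq with hy | rfl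
    · exact hx y hy
    · exact h _ hx

theorem Recursive.exists_minimal {P : M → Prop} (hP : Recursive S P) (h : ∃ x, P x) :
    ∃ x, P x ∧ ∀ y < x, ¬ P y := by
  by_contra! hcon
  obtain ⟨x, hx⟩ := h
  refine hP.not.strong_induction (fun x hx hPx => ?_) x hx
  obtain ⟨y, hy, hPy⟩ := hcon x hPx
  exact hx y hy hPy

/-- Unbounded search: a decidable relation that is total contains a function of the model, which
chooses the least witness. -/
theorem Recursive.exists_function {P : α → M → Prop}
    (hP : Recursive S (fun p : α × M => P p.1 p.2)) (h : ∀ a, ∃ m, P a m) :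
    ∃ f : α → M, Recursive S f ∧ ∀ a, P a (f a) := by
  have h' : ∀ a, ∃ x, P a x ∧ ∀ y < x, ¬ P a y := fun a =>
    exists_minimal (hP.comp (f := fun m => (a, m)) (by fun_prop)) (h a)
  choose f hf hmin using h'
  refine ⟨f, of_graph ?_, hf⟩
  have : Recursive S (fun p : α × M => P p.1 p.2 ∧ ∀ y < p.2, ¬ P p.1 y) := by
    refine hP.and (ball (α := α × M) (P := fun p y => ¬ P p.1 y) ?_ (by fun_prop))
    exact (hP.comp (f := fun q : (α × M) × M => (q.1.1, q.2)) (by fun_prop)).not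
  convert this using 2 with p
  constructor
  · intro hp
    rw [hp]
    exact ⟨hf _, hmin _⟩
  · rintro ⟨h1, h2⟩
    rcases lt_trichotomy p.2 (f p.1) with h3 | h3 | h3
    · exact absurd h1 (hmin _ _ h3)
    · exact h3
    · exact absurd (hf _) (h2 _ h3)


end Definability

/-! ### Coding of finite sequences -/

section Sequences

variable {M : Type u} [CommSemiring M] [LinearOrder M] [IsStrictOrderedRing M]
  [CanonicallyOrderedAdd M]

theorem pos_of_ne_zero {x : M} (h : x ≠ 0) : 0 < x := lt_of_le_of_ne zero_le h.symm

theorem one_le_of_pos (S : Set (Set M)) [IsModel S] {x : M} (h : 0 < x) : 1 ≤ x := by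
  simpa using (add_one_le_iff S).2 h

/-- Uniqueness of quotient and remainder. -/
theorem mul_add_inj (S : Set (Set M)) [IsModel S] {m q q' r r' : M} (hr : r < m) (hr' : r' < m)
    (h : m * q + r = m * q' + r') : q = q' ∧ r = r' := by
  have key : ∀ {q q' r r' : M}, r < m → m * q + r = m * q' + r' → q' ≤ q := by
    intro q q' r r' hr h
    by_contra! hlt
    have h1 : q + 1 ≤ q' := (add_one_le_iff S).2 hlt
    have : m * q + r < m * q' + r' :=
      calc m * q + r < m * q + m := by gcongr
        _ = m * (q + 1) := by ring
        _ ≤ m * q' := by gcongr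
        _ ≤ m * q' + r' := le_self_add
    exact this.ne h
  obtain rfl : q = q' := le_antisymm (key hr' h.symm) (key hr h)
  exact ⟨rfl, add_left_cancel h⟩

variable {S : Set (Set M)} [hS : IsModel S] {α β : Type*} [Coded S α] [Coded S β]

@[fun_prop]
theorem Recursive.dvd {f g : α → M} (hf : Recursive S f) (hg : Recursive S g) :
    Recursive S (fun a => f a ∣ g a) := by
  have h : ∀ x y : M, x ∣ y ↔ ∃ q < y + 1, y = x * q := by
    intro x y
    refine ⟨?_, fun ⟨q, _, hq⟩ => ⟨q, hq⟩⟩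
    rintro ⟨q, rfl⟩
    rcases (zero_le (a := x)).eq_or_lt with rfl | hx
    · exact ⟨0, by simp, by simp⟩
    · exact ⟨q, (lt_add_one_iff S).2 (le_mul_of_one_le_left zero_le (one_le_of_pos S hx)), rfl⟩
  simp only [h]
  exact bex (P := fun a q => g a = f a * q) (by fun_prop) (by fun_prop)

theorem exists_eq_mul_add (S : Set (Set M)) [IsModel S] {y : M} (hy : 0 < y) (x : M) :
    ∃ q r, r < y ∧ x = y * q + r := by
  have h1 : Recursive S (fun p : M × M × M => p.2.2 < y ∧ p.1 = y * p.2.1 + p.2.2) := by fun_prop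
  have h2 : ∀ x : M, (∃ p : M × M, p.2 < y ∧ x = y * p.1 + p.2) →
      ∃ p : M × M, p.2 < y ∧ x + 1 = y * p.1 + p.2 := by
    rintro x ⟨⟨q, r⟩, hr, rfl⟩
    rcases ((add_one_le_iff S).2 hr).lt_or_eq with h | h
    · exact ⟨(q, r + 1), h, by ring⟩
    · exact ⟨(q + 1, 0), hy, by rw [add_zero, mul_add, mul_one, ← h]; ring⟩
  obtain ⟨⟨q, r⟩, h⟩ := sigma_induction (P := fun x (p : M × M) => p.2 < y ∧ x = y * p.1 + p.2)
    h1 ⟨(0, 0), hy, by simp⟩ h2 x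
  exact ⟨q, r, h⟩

/-- If `x` is congruent to `r < m` modulo `m`, then `r` is the remainder of `x`. The congruence is
given with summands on both sides, as there is no subtraction. -/
theorem exists_eq_mul_add_of_add_mul_eq (S : Set (Set M)) [IsModel S] {m x a b r : M} (hr : r < m)
    (h : x + a * m = b * m + r) : ∃ c, x = c * m + r := by
  rcases le_total a b with hab | hab
  · obtain ⟨c, rfl⟩ := exists_add_of_le hab
    refine ⟨c, add_right_cancel (b := a * m) ?_⟩
    rw [h]
    ring
  · obtain ⟨c, rfl⟩ := exists_add_of_le hab
    have h1 : x + c * m = r := by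
      refine add_right_cancel (b := b * m) ?_
      rw [add_comm r, ← h]
      ring
    rcases (zero_le (a := c)).eq_or_lt with rfl | hc
    · exact ⟨0, by simpa using h1⟩
    · refine absurd h1 (lt_of_lt_of_le hr ?_).ne'
      exact (le_mul_of_one_le_left zero_le (one_le_of_pos S hc)).trans le_add_self

/-- There is an upper bound for the first `n` values of a function of the model. -/
theorem exists_bound {g : M → M} (hg : Recursive S g) (n : M) : ∃ B, ∀ i < n, g i < B := by
  refine sigma_induction (S := S) (β := M) (P := fun n B => ∀ i < n, g i < B) ?_
    ⟨0, fun i hi => absurd hi not_lt_zero⟩ ?_ n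
  · exact Recursive.ball (α := M × M) (P := fun p i => g i < p.2) (by fun_prop) (by fun_prop)
  · rintro n ⟨B, hB⟩
    refine ⟨B + g n + 1, fun i hi => (lt_add_one_iff S).2 ?_⟩
    rcases ((lt_add_one_iff S).1 hi).lt_or_eq with hi | rfl
    · exact (hB i hi).le.trans le_self_add
    · exact le_add_self

/-- There is a positive common multiple of the first `n` positive numbers. -/
theorem exists_common_multiple (S : Set (Set M)) [IsModel S] (n : M) :
    ∃ e, 0 < e ∧ ∀ j < n, j + 1 ∣ e := by
  refine sigma_induction (S := S) (β := M) (P := fun n e => 0 < e ∧ ∀ j < n, j + 1 ∣ e) ?_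
    ⟨1, one_pos, fun i hi => absurd hi not_lt_zero⟩ ?_ n
  · exact .and (by fun_prop) <|
      Recursive.ball (α := M × M) (P := fun p j => j + 1 ∣ p.2) (by fun_prop) (by fun_prop)
  · rintro n ⟨e, he, h⟩
    refine ⟨e * (n + 1), by positivity, fun j hj => ?_⟩
    rcases ((lt_add_one_iff S).1 hj).lt_or_eq with hj | rfl
    · exact (h j hj).mul_right _
    · exact dvd_mul_left _ _

/-- The `i`-th modulus for coding sequences with the parameter `d`. -/
def modulus (d i : M) : M := 1 + (i + 1) * d

@[fun_prop]
theorem Recursive.modulus {f g : α → M} (hf : Recursive S f) (hg : Recursive S g) :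
    Recursive S (fun a => modulus (f a) (g a)) := by
  unfold SecondOrderArith.modulus
  fun_prop

/-- `N` is invertible modulo `m`; it is stated as the existence of an inverse of `-N`. -/
def Invertible (N m : M) : Prop := ∃ u, m ∣ u * N + 1

/-- An inverse can be chosen below the modulus, so that invertibility is decidable. -/
theorem Invertible.exists_lt (S : Set (Set M)) [IsModel S] {N m : M} (hm : 0 < m)
    (h : Invertible N m) : ∃ u < m, m ∣ u * N + 1 := by
  obtain ⟨u, v, hv⟩ := h
  obtain ⟨q, r, hr, rfl⟩ := exists_eq_mul_add S hm u
  obtain ⟨c, hc⟩ := exists_eq_mul_add_of_add_mul_eq S (x := r * N + 1) (a := q * N) (b := v)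
    hm (by rw [add_zero, mul_comm v, ← hv]; ring)
  exact ⟨r, hr, c, by rw [hc]; ring⟩

theorem Recursive.invertible {f g : α → M} (hf : Recursive S f) (hg : Recursive S g)
    (h : ∀ a, 0 < g a) : Recursive S (fun a => Invertible (f a) (g a)) := by
  have : Recursive S (fun a => ∃ u < g a, g a ∣ u * f a + 1) :=
    bex (P := fun a u => g a ∣ u * f a + 1) (by fun_prop) (by fun_prop)
  convert this using 2 with a
  exact ⟨fun h' => h'.exists_lt S (h a), fun ⟨u, _, hu⟩ => ⟨u, hu⟩⟩

/-- The product of inverses of `-N` and `-N'` is an inverse of `N * N'`; multiplying it by `D`,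
which is `-1` modulo `1 + D`, corrects the sign. -/
theorem Invertible.mul (S : Set (Set M)) [IsModel S] {N N' D : M} (h : Invertible N (1 + D))
    (h' : Invertible N' (1 + D)) : Invertible (N * N') (1 + D) := by
  obtain ⟨u, v, hv⟩ := h
  obtain ⟨u', v', hv'⟩ := h'
  have hpos : (0 : M) < 1 + D := add_pos_of_pos_of_nonneg one_pos zero_le
  have e : u * u' * N * N' + (1 + D) * v + (1 + D) * v' = ((1 + D) * v) * ((1 + D) * v') + 1 := by
    rw [← hv, ← hv']
    ring
  obtain ⟨c, hc⟩ := exists_eq_mul_add_of_add_mul_eq S (m := 1 + D) (r := 0)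
    (x := D * u * u' * (N * N') + 1) (a := D * (v + v')) (b := D * v * v' * (1 + D) + 1) hpos
    (calc D * u * u' * (N * N') + 1 + D * (v + v') * (1 + D)
        = D * (u * u' * N * N' + (1 + D) * v + (1 + D) * v') + 1 := by ring
      _ = D * (((1 + D) * v) * ((1 + D) * v') + 1) + 1 := by rw [e]
      _ = _ := by ring)
  exact ⟨D * u * u', c, by rw [hc]; ring⟩

/-- The moduli are coprime in pairs if `d` is divisible by all differences of their indices. -/
theorem invertible_modulus (S : Set (Set M)) [IsModel S] {n d j k : M}
    (hd : ∀ j < n, j + 1 ∣ d) (hjk : j < k) (hk : k < n) :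
    Invertible (modulus d j) (modulus d k) := by
  obtain ⟨t, rfl⟩ := exists_add_of_le ((add_one_le_iff S).2 hjk)
  have ht : t < n := lt_of_le_of_lt le_add_self hk
  obtain ⟨q, rfl⟩ := hd t ht
  -- `(k + 1) * m_j - (j + 1) * m_k = k - j` for the moduli `m`; multiplied by `q = d / (k - j)` and
  -- `k + 1` the right side becomes `m_k - 1`.
  refine ⟨(j + 1 + t + 1) * (j + 1 + t + 1) * q, (j + 1 + t + 1) * q * (j + 1) + 1, ?_⟩
  unfold modulus
  ring

theorem modulus_pos (d i : M) : 0 < modulus d i := add_pos_of_pos_of_nonneg one_pos zero_le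

theorem Recursive.exists_eq_mul_add {f g h : α → M} (hf : Recursive S f) (hg : Recursive S g)
    (hh : Recursive S h) (hpos : ∀ a, 0 < g a) :
    Recursive S (fun a => ∃ q, f a = g a * q + h a) := by
  have : Recursive S (fun a => ∃ q < f a + 1, f a = g a * q + h a) :=
    bex (P := fun a q => f a = g a * q + h a) (by fun_prop) (by fun_prop)
  convert this using 2 with a
  refine ⟨fun ⟨q, hq⟩ => ⟨q, (lt_add_one_iff S).2 ?_, hq⟩, fun ⟨q, _, hq⟩ => ⟨q, hq⟩⟩
  rw [hq]
  exact (le_mul_of_one_le_left zero_le (one_le_of_pos S (hpos a))).trans le_self_add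

/-- The Chinese remainder theorem: a sequence of residues has a simultaneous solution. In the
induction, `N` is the product of the first `j` moduli. -/
theorem exists_residues {g : M → M} (hg : Recursive S g) {n d : M}
    (hd : ∀ j < n, j + 1 ∣ d) (hgd : ∀ i < n, g i < modulus d i) :
    ∃ a, ∀ i < n, ∃ q, a = modulus d i * q + g i := by
  obtain ⟨⟨a, N⟩, h⟩ := sigma_induction (S := S) (β := M × M)
    (P := fun j (p : M × M) => n < j ∨ ((∀ i < j, ∃ q, p.1 = modulus d i * q + g i) ∧
      (∀ i < j, modulus d i ∣ p.2) ∧ ∀ k < n, k < j ∨ Invertible p.2 (modulus d k)))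
    (by
      refine .or (by fun_prop) (.and ?_ (.and ?_ ?_))
      · refine .ball (P := fun (p : M × M × M) i => ∃ q, p.2.1 = modulus d i * q + g i) ?_
          (by fun_prop)
        exact .exists_eq_mul_add (by fun_prop) (by fun_prop) (by fun_prop)
          fun _ => modulus_pos _ _
      · exact .ball (P := fun (p : M × M × M) i => modulus d i ∣ p.2.2) (by fun_prop)
          (by fun_prop)
      · refine .ball (P := fun (p : M × M × M) k => k < p.1 ∨ Invertible p.2.2 (modulus d k))
          (.or (by fun_prop) ?_) (by fun_prop)
        exact .invertible (by fun_prop) (by fun_prop) fun _ => modulus_pos _ _)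
    ⟨(0, 1), Or.inr ⟨fun i hi => absurd hi not_lt_zero, fun i hi => absurd hi not_lt_zero,
      fun k _ => Or.inr ⟨(k + 1) * d, 1, by unfold modulus; ring⟩⟩⟩
    (by
      rintro j ⟨⟨a, N⟩, h | ⟨h1, h2, h3⟩⟩
      · exact ⟨(a, N), Or.inl (h.trans ((lt_add_one_iff S).2 le_rfl))⟩
      rcases le_or_gt n j with hj | hj
      · exact ⟨(a, N), Or.inl ((lt_add_one_iff S).2 hj)⟩
      obtain ⟨u, v, huv⟩ := (h3 j hj).resolve_left (lt_irrefl j)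
      -- `u` inverts `-N` and `D` is `-1` modulo `m_j`, so adding `N * u * (a + D * g j)` to `a`
      -- yields a number congruent to `-(D * g j)`, that is to `g j`.
      set D := (j + 1) * d with hD
      have hm : modulus d j = 1 + D := rfl
      dsimp only at h1 h2 h3 huv
      obtain ⟨c, hc⟩ := exists_eq_mul_add_of_add_mul_eq S (m := modulus d j)
        (x := a + N * (u * (a + D * g j))) (a := g j) (b := v * (a + D * g j)) (hgd j hj) (by
          refine add_right_cancel (b := a) ?_
          calc a + N * (u * (a + D * g j)) + g j * modulus d j + a
              = a + (u * N + 1) * (a + D * g j) + g j := by rw [hm]; ring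
            _ = _ := by rw [huv]; ring)
      refine ⟨(a + N * (u * (a + D * g j)), N * modulus d j), Or.inr ⟨?_, ?_, ?_⟩⟩
      · intro i hi
        rcases ((lt_add_one_iff S).1 hi).lt_or_eq with hi | rfl
        · obtain ⟨q, hq⟩ := h1 i hi
          obtain ⟨s, rfl⟩ := h2 i hi
          refine ⟨q + s * (u * (a + D * g j)), ?_⟩
          dsimp only
          nth_rewrite 1 [hq]
          ring
        · exact ⟨c, by rw [hc]; ring⟩
      · intro i hi
        rcases ((lt_add_one_iff S).1 hi).lt_or_eq with hi | rfl
        · exact (h2 i hi).mul_right _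
        · exact dvd_mul_left _ _
      · intro k hk
        rcases lt_or_ge k (j + 1) with hkj | hkj
        · exact Or.inl hkj
        have hjk := (add_one_le_iff S).1 hkj
        exact Or.inr (((h3 k hk).resolve_left hjk.not_gt).mul S (invertible_modulus S hd hjk hk))) n
  exact ⟨a, (h.resolve_left (lt_irrefl n)).1⟩

/-- There is a coding of finite sequences by numbers: every function of the model agrees below any
given bound with the sequence that has a suitable code `c`. -/
theorem exists_entry (S : Set (Set M)) [IsModel S] :
    ∃ f : M × M → M, Recursive S f ∧
      ∀ g : M → M, Recursive S g → ∀ n, ∃ c, ∀ i < n, f (c, i) = g i := by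
  -- `C c i r` says that `c = (a, d)` and that `r` is the remainder of `a` modulo `1 + (i + 1) * d`.
  let C : M → M → M → Prop := fun c i r => r < c + 1 ∧ ∃ a < c + 1, ∃ d < c + 1,
    c = pair a d ∧ r < modulus d i ∧ ∃ q, a = modulus d i * q + r
  have hC : Recursive S (fun p : M × M × M => C p.1 p.2.1 p.2.2) := by
    refine .and (by fun_prop) (.bex (P := fun (p : M × M × M) a => ∃ d < p.1 + 1, p.1 = pair a d ∧
      p.2.2 < modulus d p.2.1 ∧ ∃ q, a = modulus d p.2.1 * q + p.2.2) ?_ (by fun_prop))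
    refine .bex (P := fun (p : (M × M × M) × M) d => p.1.1 = pair p.2 d ∧
      p.1.2.2 < modulus d p.1.2.1 ∧ ∃ q, p.2 = modulus d p.1.2.1 * q + p.1.2.2) ?_ (by fun_prop)
    refine .and (by fun_prop) (.and (by fun_prop) ?_)
    exact .exists_eq_mul_add (by fun_prop) (by fun_prop) (by fun_prop) fun _ => modulus_pos _ _
  obtain ⟨f, hf, hfC⟩ := Recursive.exists_function (S := S) (α := M × M)
    (P := fun p r => C p.1 p.2 r ∨ ∀ r' < p.1 + 1, ¬ C p.1 p.2 r')
    (by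
      refine .or (hC.comp (f := fun p : (M × M) × M => (p.1.1, p.1.2, p.2)) (by fun_prop)) ?_
      refine .ball (P := fun (p : (M × M) × M) r' => ¬ C p.1.1 p.1.2 r') ?_ (by fun_prop)
      exact (hC.comp (f := fun p : ((M × M) × M) × M => (p.1.1.1, p.1.1.2, p.2))
        (by fun_prop)).not)
    (by
      rintro ⟨c, i⟩
      by_cases h : ∃ r, C c i r
      · exact h.imp fun _ => Or.inl
      · exact ⟨0, Or.inr fun r' _ hr' => h ⟨r', hr'⟩⟩)
  refine ⟨f, hf, fun g hg n => ?_⟩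
  obtain ⟨B, hB⟩ := exists_bound hg n
  obtain ⟨e, he, hen⟩ := exists_common_multiple S n
  have hgd : ∀ i < n, g i < modulus (e * B) i := by
    intro i hi
    calc g i < B := hB i hi
      _ ≤ e * B := le_mul_of_one_le_left zero_le (one_le_of_pos S he)
      _ ≤ (i + 1) * (e * B) := le_mul_of_one_le_left zero_le le_add_self
      _ ≤ modulus (e * B) i := le_add_self
  obtain ⟨a, ha⟩ := exists_residues hg (fun j hj => (hen j hj).mul_right B) hgd
  refine ⟨pair a (e * B), fun i hi => ?_⟩
  have h1 : C (pair a (e * B)) i (g i) := by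
    refine ⟨(lt_add_one_iff S).2 ?_, a, (lt_add_one_iff S).2 (left_le_pair _ _), e * B,
      (lt_add_one_iff S).2 (right_le_pair S _ _), rfl, hgd i hi, ha i hi⟩
    obtain ⟨q, hq⟩ := ha i hi
    exact (le_add_self.trans_eq hq.symm).trans (left_le_pair _ _)
  rcases hfC (pair a (e * B), i) with h | h
  · obtain ⟨-, a', -, d', -, hp, hlt, q', hq'⟩ := h
    obtain ⟨rfl, rfl⟩ := (pair_inj S).1 hp
    obtain ⟨q, hq⟩ := ha i hi
    exact (mul_add_inj S hlt (hgd i hi) (hq'.symm.trans hq)).2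
  · exact absurd h1 (h _ h1.1)

variable (S) in
/-- The `i`-th entry of the finite sequence with the code `c`. -/
noncomputable def entry (c i : M) : M := (exists_entry S).choose (c, i)

@[fun_prop]
theorem Recursive.entry {f g : α → M} (hf : Recursive S f) (hg : Recursive S g) :
    Recursive S (fun a => entry S (f a) (g a)) :=
  (exists_entry S).choose_spec.1.comp (hf.prodMk hg)

theorem exists_code {g : M → M} (hg : Recursive S g) (n : M) :
    ∃ c, ∀ i < n, entry S c i = g i :=
  (exists_entry S).choose_spec.2 g hg n

/-- A finite sequence can be extended. -/
theorem exists_extension (S : Set (Set M)) [IsModel S] (c n y : M) :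
    ∃ c', (∀ i < n, entry S c' i = entry S c i) ∧ entry S c' n = y := by
  obtain ⟨c', h⟩ := exists_code (S := S) (g := fun i => if i < n then entry S c i else y)
    (by fun_prop) (n + 1)
  refine ⟨c', fun i hi => ?_, ?_⟩
  · rw [h i ((lt_add_one_iff S).2 hi.le), if_pos hi]
  · rw [h n ((lt_add_one_iff S).2 le_rfl), if_neg (lt_irrefl n)]

/-! ### Recursion -/

/-- Primitive recursion with parameters. -/
theorem exists_primitive_recursion {g : α → M} {h : α → M → M → M} (hg : Recursive S g)
    (hh : Recursive S (fun p : α × M × M => h p.1 p.2.1 p.2.2)) :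
    ∃ f : α → M → M, Recursive S (fun p : α × M => f p.1 p.2) ∧ (∀ a, f a 0 = g a) ∧
      ∀ a n, f a (n + 1) = h a n (f a n) := by
  -- `R a n c` says that `c` codes the values up to `n`.
  let R : α → M → M → Prop := fun a n c =>
    entry S c 0 = g a ∧ ∀ i < n, entry S c (i + 1) = h a i (entry S c i)
  have hR : Recursive S (fun p : (α × M) × M => R p.1.1 p.1.2 p.2) := by
    refine .and (by fun_prop) (.ball (P := fun (p : (α × M) × M) i =>
      entry S p.2 (i + 1) = h p.1.1 i (entry S p.2 i)) ?_ (by fun_prop))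
    refine .eq (by fun_prop) (hh.comp (f := fun p : ((α × M) × M) × M =>
      (p.1.1.1, p.2, entry S p.1.2 p.2)) (by fun_prop))
  have hex : ∀ p : α × M, ∃ c, R p.1 p.2 c := by
    rintro ⟨a, n⟩
    refine sigma_induction (S := S) (β := M) (P := fun n c => R a n c)
      (hR.comp (f := fun p : M × M => ((a, p.1), p.2)) (by fun_prop)) ?_ ?_ n
    · obtain ⟨c, -, hc⟩ := exists_extension S 0 0 (g a)
      exact ⟨c, hc, fun i hi => absurd hi not_lt_zero⟩
    · rintro n ⟨c, h0, h1⟩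
      obtain ⟨c', h2, h3⟩ := exists_extension S c (n + 1) (h a n (entry S c n))
      refine ⟨c', ?_, fun i hi => ?_⟩
      · rw [h2 0 (by positivity), h0]
      · rw [h2 i hi]
        rcases ((lt_add_one_iff S).1 hi).lt_or_eq with hi | rfl
        · rw [h2 (i + 1) (by gcongr), h1 i hi]
        · exact h3
  obtain ⟨C, hC, hCR⟩ := Recursive.exists_function hR hex
  have huniq : ∀ a n c c', R a n c → R a n c' → ∀ i ≤ n, entry S c i = entry S c' i := by
    intro a n c c' hc hc' i
    refine Recursive.induction (S := S) (P := fun i => i ≤ n → entry S c i = entry S c' i)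
      (.imp (by fun_prop) (by fun_prop)) ?_ ?_ i
    · intro _
      rw [hc.1, hc'.1]
    · intro i hi hin
      have hlt := (add_one_le_iff S).1 hin
      rw [hc.2 i hlt, hc'.2 i hlt, hi hlt.le]
  refine ⟨fun a n => entry S (C (a, n)) n, by fun_prop, fun a => (hCR (a, 0)).1, fun a n => ?_⟩
  have h1 := hCR (a, n + 1)
  have h2 : R a n (C (a, n + 1)) :=
    ⟨h1.1, fun i hi => h1.2 i (hi.trans ((lt_add_one_iff S).2 le_rfl))⟩
  dsimp only
  rw [h1.2 n ((lt_add_one_iff S).2 le_rfl), huniq a n _ _ h2 (hCR (a, n)) n le_rfl]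

/-- Course-of-values recursion with parameters: the value at `x` is determined by a code for the
sequence of the previous values. -/
theorem exists_course_of_values_recursion {G : α → M → M → M}
    (hG : Recursive S (fun p : α × M × M => G p.1 p.2.1 p.2.2)) :
    ∃ f : α → M → M, Recursive S (fun p : α × M => f p.1 p.2) ∧
      ∀ a x, ∃ c, (∀ i < x, entry S c i = f a i) ∧ f a x = G a x c := by
  obtain ⟨E, hE, hE'⟩ := Recursive.exists_function (S := S) (α := M × M × M)
    (P := fun p c' => (∀ i < p.2.1, entry S c' i = entry S p.1 i) ∧ entry S c' p.2.1 = p.2.2)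
    (.and (.ball (P := fun (p : (M × M × M) × M) i => entry S p.2 i = entry S p.1.1 i)
      (by fun_prop) (by fun_prop)) (by fun_prop))
    (fun p => exists_extension S p.1 p.2.1 p.2.2)
  obtain ⟨s, hs, -, hs1⟩ := exists_primitive_recursion (S := S) (α := α) (g := fun _ => 0)
    (h := fun a n c => E (c, n, G a n c)) (by fun_prop) (by fun_prop)
  refine ⟨fun a x => entry S (s a (x + 1)) x, ?_, fun a x => ⟨s a x, ?_, ?_⟩⟩
  · exact .entry (hs.comp (f := fun p : α × M => (p.1, p.2 + 1)) (by fun_prop)) (by fun_prop)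
  · have hs2 : Recursive S (fun x => s a x) :=
      hs.comp (f := fun x : M => (a, x)) (by fun_prop)
    refine Recursive.induction (S := S)
      (P := fun x => ∀ i < x, entry S (s a x) i = entry S (s a (i + 1)) i) ?_ ?_ ?_ x
    · exact .ball (P := fun (x : M) i => entry S (s a x) i = entry S (s a (i + 1)) i)
        (by fun_prop) (by fun_prop)
    · exact fun i hi => absurd hi not_lt_zero
    · intro x hx i hi
      rcases ((lt_add_one_iff S).1 hi).lt_or_eq with hi | rfl
      · rw [hs1, (hE' _).1 i hi, hx i hi]
      · rfl
  · dsimp only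
    rw [hs1, (hE' _).2]

end Sequences

section Codes

variable {M : Type u} [CommSemiring M] [LinearOrder M] [IsStrictOrderedRing M]
  [CanonicallyOrderedAdd M] {S : Set (Set M)} [hS : IsModel S] {α β : Type*} [Coded S α] [Coded S β]

open Classical in
/-- Course-of-values recursion for predicates. -/
theorem exists_recursive_predicate {G : α → M → M → Prop}
    (hG : Recursive S (fun p : α × M × M => G p.1 p.2.1 p.2.2)) :
    ∃ Q : α → M → Prop, Recursive S (fun p : α × M => Q p.1 p.2) ∧
      ∀ a x, ∃ c, (∀ i < x, entry S c i = 1 ↔ Q a i) ∧ (Q a x ↔ G a x c) := by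
  obtain ⟨f, hf, hfG⟩ := exists_course_of_values_recursion (S := S) (α := α)
    (G := fun a x c => if G a x c then 1 else 0) (by fun_prop)
  refine ⟨fun a x => f a x = 1, by fun_prop, fun a x => ?_⟩
  obtain ⟨c, h1, h2⟩ := hfG a x
  refine ⟨c, fun i hi => by rw [h1 i hi], ?_⟩
  dsimp only
  rw [h2]
  split_ifs with h <;> simp [h]

/-! ### Pairs and codes of terms -/

variable (S) in
theorem exists_pred : ∃ f : M → M, Recursive S f ∧ ∀ x, IsPred x (f x) :=
  Recursive.exists_function (S := S) (α := M) (P := IsPred)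
    (by unfold IsPred; fun_prop) (fun x => by
      rcases hS.models.eq_zero_or_succ hS.nonempty x with h | ⟨y, hy⟩
      · exact ⟨0, Or.inl ⟨h, rfl⟩⟩
      · exact ⟨y, Or.inr hy⟩)

theorem IsPred.eq_of_succ (S : Set (Set M)) [hS : IsModel S] {x y : M} (h : IsPred (x + 1) y) :
    y = x := by
  rcases h with h | h
  · exact absurd h.1 (hS.models.succ_ne_zero x)
  · exact (add_right_cancel h).symm

variable (S) in
theorem exists_unpair : ∃ f g : M → M, Recursive S f ∧ Recursive S g ∧
    ∀ x y, f (pair x y) = x ∧ g (pair x y) = y := by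
  have hno : Recursive S (fun z : M => ∀ x < z + 1, ∀ y < z + 1, z ≠ pair x y) :=
    .ball (P := fun (z : M) x => ∀ y < z + 1, z ≠ pair x y)
      (.ball (P := fun (p : M × M) y => p.1 ≠ pair p.2 y) (by unfold Ne; fun_prop) (by fun_prop))
      (by fun_prop)
  have hyes : ∀ x y : M, ¬ ∀ x' < pair x y + 1, ∀ y' < pair x y + 1, pair x y ≠ pair x' y' :=
    fun x y h => h x ((lt_add_one_iff S).2 (left_le_pair x y)) y
      ((lt_add_one_iff S).2 (right_le_pair S x y)) rfl
  obtain ⟨f, hf, h⟩ := Recursive.exists_function (S := S) (α := M)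
    (P := fun z x => (∃ y < z + 1, z = pair x y) ∨ ∀ x < z + 1, ∀ y < z + 1, z ≠ pair x y)
    (.or (.bex (P := fun (p : M × M) y => p.1 = pair p.2 y) (by fun_prop) (by fun_prop))
      (hno.comp (f := fun p : M × M => p.1) (by fun_prop)))
    (fun z => by
      by_cases hz : ∀ x < z + 1, ∀ y < z + 1, z ≠ pair x y
      · exact ⟨0, Or.inr hz⟩
      · push Not at hz
        obtain ⟨x, -, y, hy, hz⟩ := hz
        exact ⟨x, Or.inl ⟨y, hy, hz⟩⟩)
  obtain ⟨g, hg, h'⟩ := Recursive.exists_function (S := S) (α := M)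
    (P := fun z y => (∃ x < z + 1, z = pair x y) ∨ ∀ x < z + 1, ∀ y < z + 1, z ≠ pair x y)
    (.or (.bex (P := fun (p : M × M) x => p.1 = pair x p.2) (by fun_prop) (by fun_prop))
      (hno.comp (f := fun p : M × M => p.1) (by fun_prop)))
    (fun z => by
      by_cases hz : ∀ x < z + 1, ∀ y < z + 1, z ≠ pair x y
      · exact ⟨0, Or.inr hz⟩
      · push Not at hz
        obtain ⟨x, hx, y, hy, hz⟩ := hz
        exact ⟨y, Or.inl ⟨x, hx, hz⟩⟩)
  refine ⟨f, g, hf, hg, fun x y => ⟨?_, ?_⟩⟩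
  · obtain ⟨y', -, hy⟩ := (h (pair x y)).resolve_right (hyes x y)
    exact ((pair_inj S).1 hy).1.symm
  · obtain ⟨y', -, hy⟩ := (h' (pair x y)).resolve_right (hyes x y)
    exact ((pair_inj S).1 hy).2.symm

/-- Induction on pairs, for the order in which both components decrease. -/
theorem Recursive.pair_induction {P : M → M → Prop} (hP : Recursive S (fun p : M × M => P p.1 p.2))
    (h : ∀ x y, (∀ x' < x, ∀ y' < y, P x' y') → P x y) (x y : M) : P x y := by
  obtain ⟨f, g, hf, hg, hfg⟩ := exists_unpair S
  have key := Recursive.strong_induction (S := S)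
    (P := fun z => z = SecondOrderArith.pair (f z) (g z) → P (f z) (g z))
    (.imp (by fun_prop) (hP.comp (f := fun z => (f z, g z)) (by fun_prop)))
    (fun z ih hz => h _ _ fun x' hx' y' hy' => by
      have := ih (SecondOrderArith.pair x' y') (by rw [hz]; exact pair_lt_pair S hx' hy')
      rw [(hfg x' y').1, (hfg x' y').2] at this
      exact this rfl) (SecondOrderArith.pair x y)
  rw [(hfg x y).1, (hfg x y).2] at key
  exact key rfl

variable (S) in
theorem exists_decode : ∃ f g h : M → M, Recursive S f ∧ Recursive S g ∧ Recursive S h ∧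
    ∀ e k a, f (oadd e k a) = e ∧ g (oadd e k a) = k ∧ h (oadd e k a) = a := by
  obtain ⟨f, g, hf, hg, hfg⟩ := exists_unpair S
  obtain ⟨p, hp, hp'⟩ := exists_pred S
  refine ⟨fun x => f (p x), fun x => f (g (p x)), fun x => g (g (p x)), by fun_prop, by fun_prop,
    by fun_prop, fun e k a => ?_⟩
  simp [oadd, (hp' _).eq_of_succ S, hfg]

variable (S) in
/-- The leading exponent of a code `oadd e k a`; nothing is known about it at other numbers. -/
noncomputable def expo : M → M := (exists_decode S).choose

variable (S) in
/-- The leading coefficient of a code `oadd e k a`; unspecified at other numbers. -/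
noncomputable def coef : M → M := (exists_decode S).choose_spec.choose

variable (S) in
/-- The code of the sum without its leading term; unspecified at numbers that are not of the form
`oadd e k a`. -/
noncomputable def tail : M → M := (exists_decode S).choose_spec.choose_spec.choose

@[fun_prop]
theorem Recursive.expo {f : α → M} (hf : Recursive S f) : Recursive S (fun a => expo S (f a)) :=
  (exists_decode S).choose_spec.choose_spec.choose_spec.1.comp hf

@[fun_prop]
theorem Recursive.coef {f : α → M} (hf : Recursive S f) : Recursive S (fun a => coef S (f a)) :=
  (exists_decode S).choose_spec.choose_spec.choose_spec.2.1.comp hf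

@[fun_prop]
theorem Recursive.tail {f : α → M} (hf : Recursive S f) : Recursive S (fun a => tail S (f a)) :=
  (exists_decode S).choose_spec.choose_spec.choose_spec.2.2.1.comp hf

@[simp]
theorem expo_oadd (e k a : M) : expo S (oadd e k a) = e :=
  ((exists_decode S).choose_spec.choose_spec.choose_spec.2.2.2 e k a).1

@[simp]
theorem coef_oadd (e k a : M) : coef S (oadd e k a) = k :=
  ((exists_decode S).choose_spec.choose_spec.choose_spec.2.2.2 e k a).2.1

@[simp]
theorem tail_oadd (e k a : M) : tail S (oadd e k a) = a :=
  ((exists_decode S).choose_spec.choose_spec.choose_spec.2.2.2 e k a).2.2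

@[fun_prop]
theorem Recursive.oadd {f g h : α → M} (hf : Recursive S f) (hg : Recursive S g)
    (hh : Recursive S h) : Recursive S (fun a => oadd (f a) (g a) (h a)) := by
  unfold SecondOrderArith.oadd
  fun_prop

theorem oadd_inj (S : Set (Set M)) [IsModel S] {e k a e' k' a' : M} :
    oadd e k a = oadd e' k' a' ↔ e = e' ∧ k = k' ∧ a = a' := by
  refine ⟨fun h => ⟨?_, ?_, ?_⟩, by rintro ⟨rfl, rfl, rfl⟩; rfl⟩
  · simpa using congrArg (expo S) h
  · simpa using congrArg (coef S) h
  · simpa using congrArg (tail S) h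

theorem oadd_pos (e k a : M) : 0 < oadd e k a := add_pos_of_nonneg_of_pos zero_le one_pos

theorem oadd_ne_zero (e k a : M) : oadd e k a ≠ 0 := (oadd_pos e k a).ne'

theorem lt_oadd_expo (S : Set (Set M)) [IsModel S] (e k a : M) : e < oadd e k a :=
  (lt_add_one_iff S).2 (left_le_pair _ _)

theorem lt_oadd_coef (S : Set (Set M)) [IsModel S] (e k a : M) : k < oadd e k a :=
  (lt_add_one_iff S).2 ((left_le_pair _ _).trans (right_le_pair S _ _))

theorem lt_oadd_tail (S : Set (Set M)) [IsModel S] (e k a : M) : a < oadd e k a :=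
  (lt_add_one_iff S).2 ((right_le_pair S _ _).trans (right_le_pair S _ _))

/-! ### The order on codes -/

variable (S) in
/-- The order on codes is defined by course-of-values recursion on the codes of pairs. -/
theorem exists_ordLt : ∃ L ∈ S, IsOrdLtSet L := by
  obtain ⟨f, g, hf, hg, hfg⟩ := exists_unpair S
  obtain ⟨Q, hQ, hQ'⟩ := exists_recursive_predicate (S := S) (α := M)
    (G := fun _ z c => (f z = 0 ∧ ¬ g z = 0) ∨
      (f z = oadd (expo S (f z)) (coef S (f z)) (tail S (f z)) ∧
        g z = oadd (expo S (g z)) (coef S (g z)) (tail S (g z)) ∧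
        (entry S c (pair (expo S (f z)) (expo S (g z))) = 1 ∨
          (expo S (f z) = expo S (g z) ∧ (coef S (f z) < coef S (g z) ∨
            (coef S (f z) = coef S (g z) ∧
              entry S c (pair (tail S (f z)) (tail S (g z))) = 1)))))) (by fun_prop)
  refine ⟨{z | Q 0 z}, Recursive.setOf_mem (hQ.comp (f := fun z => (0, z)) (by fun_prop)), ?_⟩
  intro x y
  obtain ⟨c, hc, hc'⟩ := hQ' 0 (pair x y)
  rw [(hfg x y).1, (hfg x y).2] at hc'
  refine hc'.trans (or_congr Iff.rfl ?_)
  constructor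
  · rintro ⟨hx, hy, h⟩
    refine ⟨_, _, _, _, _, _, hx, hy, ?_⟩
    have h1 : pair (expo S x) (expo S y) < pair x y := by
      refine pair_lt_pair S ?_ ?_
      · nth_rewrite 2 [hx]
        exact lt_oadd_expo S _ _ _
      · nth_rewrite 2 [hy]
        exact lt_oadd_expo S _ _ _
    have h2 : pair (tail S x) (tail S y) < pair x y := by
      refine pair_lt_pair S ?_ ?_
      · nth_rewrite 2 [hx]
        exact lt_oadd_tail S _ _ _
      · nth_rewrite 2 [hy]
        exact lt_oadd_tail S _ _ _
    rwa [hc _ h1, hc _ h2] at h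
  · rintro ⟨e, k, a, e', k', a', rfl, rfl, h⟩
    have h1 := pair_lt_pair S (lt_oadd_expo S e k a) (lt_oadd_expo S e' k' a')
    have h2 := pair_lt_pair S (lt_oadd_tail S e k a) (lt_oadd_tail S e' k' a')
    simp only [expo_oadd, coef_oadd, tail_oadd, hc _ h1, hc _ h2, true_and]
    exact h

/-- A set of the model that is an order on codes is determined by its recursive characterization. -/
theorem IsOrdLtSet.pair_mem_iff {L L' : Set M} (hL : L ∈ S) (hL' : L' ∈ S) (h : IsOrdLtSet L)
    (h' : IsOrdLtSet L') (x y : M) : pair x y ∈ L ↔ pair x y ∈ L' := by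
  refine Recursive.pair_induction (S := S) (P := fun x y => pair x y ∈ L ↔ pair x y ∈ L')
    (.iff (.mem hL (by fun_prop)) (.mem hL' (by fun_prop))) (fun x y ih => ?_) x y
  rw [h x y, h' x y]
  refine or_congr Iff.rfl ?_
  constructor
  · rintro ⟨e, k, a, e', k', a', rfl, rfl, h⟩
    rw [ih _ (lt_oadd_expo S e k a) _ (lt_oadd_expo S e' k' a'),
      ih _ (lt_oadd_tail S e k a) _ (lt_oadd_tail S e' k' a')] at h
    exact ⟨e, k, a, e', k', a', rfl, rfl, h⟩
  · rintro ⟨e, k, a, e', k', a', rfl, rfl, h⟩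
    rw [← ih _ (lt_oadd_expo S e k a) _ (lt_oadd_expo S e' k' a'),
      ← ih _ (lt_oadd_tail S e k a) _ (lt_oadd_tail S e' k' a')] at h
    exact ⟨e, k, a, e', k', a', rfl, rfl, h⟩

theorem ordLt_iff_mem {L : Set M} (hL : L ∈ S) (h : IsOrdLtSet L) {x y : M} :
    OrdLt S x y ↔ pair x y ∈ L :=
  ⟨fun ⟨_, hL', h', hxy⟩ => (IsOrdLtSet.pair_mem_iff hL' hL h' h x y).1 hxy,
    fun hxy => ⟨L, hL, h, hxy⟩⟩

@[fun_prop]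
theorem Recursive.ordLt {f g : α → M} (hf : Recursive S f) (hg : Recursive S g) :
    Recursive S (fun a => OrdLt S (f a) (g a)) := by
  obtain ⟨L, hL, h⟩ := exists_ordLt S
  simp only [ordLt_iff_mem hL h]
  exact .mem hL (by fun_prop)

theorem ordLt_iff {x y : M} : OrdLt S x y ↔ (x = 0 ∧ y ≠ 0) ∨
    ∃ e k a e' k' a', x = oadd e k a ∧ y = oadd e' k' a' ∧
      (OrdLt S e e' ∨ (e = e' ∧ (k < k' ∨ (k = k' ∧ OrdLt S a a')))) := by
  obtain ⟨L, hL, h⟩ := exists_ordLt S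
  simp only [ordLt_iff_mem hL h]
  exact h x y

theorem not_ordLt_zero {x : M} : ¬ OrdLt S x 0 := by
  rw [ordLt_iff]
  rintro (h | ⟨_, _, _, _, _, _, -, h, -⟩)
  · exact h.2 rfl
  · exact oadd_ne_zero _ _ _ h.symm

theorem zero_ordLt_oadd (e k a : M) : OrdLt S 0 (oadd e k a) :=
  ordLt_iff.2 (Or.inl ⟨rfl, oadd_ne_zero _ _ _⟩)

theorem oadd_ordLt_oadd {e k a e' k' a' : M} : OrdLt S (oadd e k a) (oadd e' k' a') ↔
    OrdLt S e e' ∨ (e = e' ∧ (k < k' ∨ (k = k' ∧ OrdLt S a a'))) := by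
  rw [ordLt_iff]
  constructor
  · rintro (h | ⟨_, _, _, _, _, _, hx, hy, h⟩)
    · exact absurd h.1 (oadd_ne_zero _ _ _)
    · obtain ⟨rfl, rfl, rfl⟩ := (oadd_inj S).1 hx
      obtain ⟨rfl, rfl, rfl⟩ := (oadd_inj S).1 hy
      exact h
  · exact fun h => Or.inr ⟨_, _, _, _, _, _, rfl, rfl, h⟩

theorem OrdLt.asymm {x y : M} (h : OrdLt S x y) : ¬ OrdLt S y x := by
  refine Recursive.pair_induction (S := S) (P := fun x y => OrdLt S x y → ¬ OrdLt S y x)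
    (.imp (by fun_prop) (by fun_prop)) (fun x y ih hxy hyx => ?_) x y h
  rcases ordLt_iff.1 hxy with ⟨rfl, -⟩ | ⟨e, k, a, e', k', a', rfl, rfl, h⟩
  · exact not_ordLt_zero hyx
  · rw [oadd_ordLt_oadd] at hyx
    have h1 := ih _ (lt_oadd_expo S e k a) _ (lt_oadd_expo S e' k' a')
    have h2 := ih _ (lt_oadd_tail S e k a) _ (lt_oadd_tail S e' k' a')
    have h3 : OrdLt S e e' → e ≠ e' := by
      rintro h rfl
      exact h1 h h
    have h4 : OrdLt S e' e → e ≠ e' := by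
      rintro h rfl
      exact h1 h h
    rcases h with h | ⟨rfl, h | ⟨rfl, h⟩⟩ <;>
      rcases hyx with h' | ⟨he, h' | ⟨hk, h'⟩⟩
    · exact h1 h h'
    · exact h3 h he.symm
    · exact h3 h he.symm
    · exact h4 h' rfl
    · exact h.asymm h'
    · exact h.ne' hk
    · exact h4 h' rfl
    · exact h'.ne rfl
    · exact h2 h h'

theorem OrdLt.irrefl (x : M) : ¬ OrdLt S x x := fun h => h.asymm h

end Codes

section Representations

variable {M : Type u} [CommSemiring M] [LinearOrder M] [IsStrictOrderedRing M]
  [CanonicallyOrderedAdd M] {S : Set (Set M)} [hS : IsModel S] {α β : Type*} [Coded S α] [Coded S β]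

/-! ### Bounded Cantor normal forms -/

variable (S) in
theorem exists_cnf : ∃ Q : M → M → Prop, Recursive S (fun p : M × M => Q p.1 p.2) ∧
    ∀ b x, Q b x ↔ x = 0 ∨ ∃ e k a, x = oadd e k a ∧ Q b e ∧ 0 < k ∧ k < b ∧ Q b a ∧
      (a = 0 ∨ ∃ e' k' a', a = oadd e' k' a' ∧ OrdLt S e' e) := by
  obtain ⟨Q, hQ, hQ'⟩ := exists_recursive_predicate (S := S) (α := M)
    (G := fun b x c => x = 0 ∨ (x = oadd (expo S x) (coef S x) (tail S x) ∧
      entry S c (expo S x) = 1 ∧ 0 < coef S x ∧ coef S x < b ∧ entry S c (tail S x) = 1 ∧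
      (tail S x = 0 ∨ (tail S x = oadd (expo S (tail S x)) (coef S (tail S x)) (tail S (tail S x)) ∧
        OrdLt S (expo S (tail S x)) (expo S x))))) (by fun_prop)
  refine ⟨Q, hQ, fun b x => ?_⟩
  obtain ⟨c, hc, hc'⟩ := hQ' b x
  rw [hc']
  refine or_congr Iff.rfl ?_
  constructor
  · rintro ⟨hx, h1, h2, h3, h4, h5⟩
    have he : expo S x < x := by
      nth_rewrite 2 [hx]
      exact lt_oadd_expo S _ _ _
    have ha : tail S x < x := by
      nth_rewrite 2 [hx]
      exact lt_oadd_tail S _ _ _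
    exact ⟨_, _, _, hx, (hc _ he).1 h1, h2, h3, (hc _ ha).1 h4,
      h5.imp_right fun h => ⟨_, _, _, h.1, h.2⟩⟩
  · rintro ⟨e, k, a, rfl, h1, h2, h3, h4, h5⟩
    simp only [expo_oadd, coef_oadd, tail_oadd, hc _ (lt_oadd_expo S e k a),
      hc _ (lt_oadd_tail S e k a), true_and]
    refine ⟨h1, h2, h3, h4, h5.imp_right ?_⟩
    rintro ⟨e', k', a', rfl, h⟩
    simpa using h

variable (S) in
/-- `x` codes a complete Cantor normal form all of whose coefficients, also those in the exponents,
are smaller than `b`. -/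
def BddCNF (b x : M) : Prop := (exists_cnf S).choose b x

theorem bddCNF_iff {b x : M} : BddCNF S b x ↔ x = 0 ∨ ∃ e k a, x = oadd e k a ∧ BddCNF S b e ∧
    0 < k ∧ k < b ∧ BddCNF S b a ∧ (a = 0 ∨ ∃ e' k' a', a = oadd e' k' a' ∧ OrdLt S e' e) :=
  (exists_cnf S).choose_spec.2 b x

@[fun_prop]
theorem Recursive.bddCNF {f g : α → M} (hf : Recursive S f) (hg : Recursive S g) :
    Recursive S (fun a => BddCNF S (f a) (g a)) :=
  (exists_cnf S).choose_spec.1.comp (hf.prodMk hg)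

theorem bddCNF_zero (b : M) : BddCNF S b 0 := bddCNF_iff.2 (Or.inl rfl)

theorem bddCNF_oadd {b e k a : M} : BddCNF S b (oadd e k a) ↔ BddCNF S b e ∧
    0 < k ∧ k < b ∧ BddCNF S b a ∧ (a = 0 ∨ ∃ e' k' a', a = oadd e' k' a' ∧ OrdLt S e' e) := by
  rw [bddCNF_iff]
  constructor
  · rintro (h | ⟨_, _, _, h, h'⟩)
    · exact absurd h (oadd_ne_zero _ _ _)
    · obtain ⟨rfl, rfl, rfl⟩ := (oadd_inj S).1 h
      exact h'
  · exact fun h => Or.inr ⟨_, _, _, rfl, h⟩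

/-- Induction along bounded Cantor normal forms. -/
theorem BddCNF.induction {b : M} {P : M → Prop} (hP : Recursive S P) (h0 : P 0)
    (h1 : ∀ e k a, BddCNF S b e → 0 < k → k < b → BddCNF S b a →
      (a = 0 ∨ ∃ e' k' a', a = oadd e' k' a' ∧ OrdLt S e' e) → P e → P a → P (oadd e k a))
    {x : M} (hx : BddCNF S b x) : P x := by
  refine Recursive.strong_induction (S := S) (P := fun x => BddCNF S b x → P x)
    (.imp (by fun_prop) (by fun_prop)) (fun x ih hx => ?_) x hx
  rcases bddCNF_iff.1 hx with rfl | ⟨e, k, a, rfl, he, hk, hkb, ha, hea⟩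
  · exact h0
  · exact h1 e k a he hk hkb ha hea (ih _ (lt_oadd_expo S e k a) he)
      (ih _ (lt_oadd_tail S e k a) ha)

theorem BddCNF.mono {b b' x : M} (h : BddCNF S b x) (hb : b ≤ b') : BddCNF S b' x :=
  h.induction (P := fun x => BddCNF S b' x) (by fun_prop) (bddCNF_zero b')
    fun _ _ _ _ hk hkb _ hea he' ha' => bddCNF_oadd.2 ⟨he', hk, hkb.trans_le hb, ha', hea⟩

/-- A code is an upper bound for the coefficients of the coded term. -/
theorem BddCNF.of_le {b b' x : M} (h : BddCNF S b x) (hb : x ≤ b') : BddCNF S b' x := by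
  refine h.induction (P := fun x => x ≤ b' → BddCNF S b' x) (.imp (by fun_prop) (by fun_prop))
    (fun _ => bddCNF_zero b') ?_ hb
  intro e k a _ hk _ _ hea he' ha' hle
  exact bddCNF_oadd.2 ⟨he' ((lt_oadd_expo S e k a).le.trans hle), hk,
    (lt_oadd_coef S e k a).trans_le hle, ha' ((lt_oadd_tail S e k a).le.trans hle), hea⟩

/-- The set of all codes of normal forms consists of those `x` that are normal forms with the
coefficient bound `x`. -/
theorem BddCNF.isCNF {b x : M} (h : BddCNF S b x) : IsCNF S x := by
  refine ⟨{x | BddCNF S x x}, Recursive.setOf_mem (by fun_prop), fun x => ?_, h.of_le le_rfl⟩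
  constructor
  · intro hx
    rcases bddCNF_iff.1 hx with rfl | ⟨e, k, a, rfl, he, hk, -, ha, hea⟩
    · exact Or.inl rfl
    · exact Or.inr ⟨e, k, a, rfl, he.of_le le_rfl, hk, ha.of_le le_rfl, hea⟩
  · rintro (rfl | ⟨e, k, a, rfl, he, hk, ha, hea⟩)
    · exact bddCNF_zero 0
    · exact bddCNF_oadd.2 ⟨he.mono (lt_oadd_expo S e k a).le, hk, lt_oadd_coef S e k a,
        ha.mono (lt_oadd_tail S e k a).le, hea⟩

theorem IsCNF.bddCNF {b x : M} (h : IsCNF S x) (hb : x ≤ b) : BddCNF S b x := by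
  obtain ⟨C, hC, hC', hx⟩ := h
  refine Recursive.strong_induction (S := S) (P := fun x => x ∈ C → x ≤ b → BddCNF S b x)
    (.imp (.mem hC (by fun_prop)) (.imp (by fun_prop) (by fun_prop)))
    (fun x ih hx hb => ?_) x hx hb
  rcases (hC' x).1 hx with rfl | ⟨e, k, a, rfl, he, hk, ha, hea⟩
  · exact bddCNF_zero b
  · exact bddCNF_oadd.2 ⟨ih e (lt_oadd_expo S e k a) he ((lt_oadd_expo S e k a).le.trans hb), hk,
      (lt_oadd_coef S e k a).trans_le hb,
      ih a (lt_oadd_tail S e k a) ha ((lt_oadd_tail S e k a).le.trans hb), hea⟩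

/-! ### Exponentiation -/

variable (S) in
theorem exists_power : ∃ f : M → M → M, Recursive S (fun p : M × M => f p.1 p.2) ∧
    (∀ b, f b 0 = 1) ∧ ∀ b n, f b (n + 1) = f b n * b :=
  exists_primitive_recursion (S := S) (α := M) (g := fun _ => 1) (h := fun b _ y => y * b)
    (by fun_prop) (by fun_prop)

variable (S) in
/-- The power `b ^ n`, for a number `n` of the model. -/
noncomputable def power (b n : M) : M := (exists_power S).choose b n

@[fun_prop]
theorem Recursive.power {f g : α → M} (hf : Recursive S f) (hg : Recursive S g) :
    Recursive S (fun a => power S (f a) (g a)) :=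
  (exists_power S).choose_spec.1.comp (hf.prodMk hg)

@[simp]
theorem power_zero (b : M) : power S b 0 = 1 := (exists_power S).choose_spec.2.1 b

theorem power_succ (b n : M) : power S b (n + 1) = power S b n * b :=
  (exists_power S).choose_spec.2.2 b n

theorem isPow_iff {b n p : M} : IsPow S b n p ↔ p = power S b n := by
  constructor
  · rintro ⟨e, he, h0, h1, rfl⟩
    have he' : Recursive S e := he
    refine Recursive.induction (S := S) (P := fun n => e n = power S b n) (by fun_prop) ?_ ?_ n
    · rw [h0, power_zero]
    · intro n hn
      rw [h1, power_succ, hn]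
  · rintro rfl
    exact ⟨fun n => power S b n, recursive_iff_isFunctionOf.1 (by fun_prop), power_zero b,
      power_succ b, rfl⟩

theorem power_pos {b : M} (hb : 0 < b) (n : M) : 0 < power S b n := by
  refine Recursive.induction (S := S) (P := fun n => 0 < power S b n) (by fun_prop) ?_ ?_ n
  · rw [power_zero]
    exact one_pos
  · intro n hn
    rw [power_succ]
    positivity

theorem power_mono {b : M} (hb : 0 < b) {n n' : M} (h : n ≤ n') :
    power S b n ≤ power S b n' := by
  obtain ⟨t, rfl⟩ := exists_add_of_le h
  refine Recursive.induction (S := S) (P := fun t => power S b n ≤ power S b (n + t))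
    (by fun_prop) (by rw [add_zero]) ?_ t
  intro t ht
  rw [← add_assoc, power_succ]
  exact ht.trans (le_mul_of_one_le_right zero_le (one_le_of_pos S hb))

theorem lt_power {b : M} (hb : 1 < b) (n : M) : n < power S b n := by
  refine Recursive.induction (S := S) (P := fun n => n < power S b n) (by fun_prop) ?_ ?_ n
  · rw [power_zero]
    exact one_pos
  · intro n hn
    have hb' : 1 + 1 ≤ b := (add_one_le_iff S).2 hb
    have h1 : (1 : M) ≤ power S b n := one_le_of_pos S (power_pos (one_pos.trans hb) n)
    calc n + 1 < power S b n + power S b n := add_lt_add_of_lt_of_le hn h1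
      _ = power S b n * (1 + 1) := by ring
      _ ≤ power S b (n + 1) := by rw [power_succ]; gcongr

/-- A leading term `b ^ n * k` and a remainder are bounded by the next power of `b`. -/
theorem power_mul_add_lt {b n k r : M} (hk : k < b) (hr : r < power S b n) :
    power S b n * k + r < power S b (n + 1) :=
  calc power S b n * k + r < power S b n * k + power S b n := by gcongr
    _ = power S b n * (k + 1) := by ring
    _ ≤ power S b (n + 1) := by
      rw [power_succ]
      gcongr
      exact (add_one_le_iff S).2 hk

theorem power_le_power_mul_add {b n k r : M} (hk : 0 < k) :
    power S b n ≤ power S b n * k + r :=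
  (le_mul_of_one_le_right zero_le (one_le_of_pos S hk)).trans le_self_add

/-! ### Complete representations in a base -/

theorem exists_representation (S : Set (Set M)) [IsModel S] {b : M} (hb : 1 < b) {m : M}
    (hm : 0 < m) : ∃ n k r, m = power S b n * k + r ∧ 0 < k ∧ k < b ∧ r < power S b n := by
  have hb0 : 0 < b := one_pos.trans hb
  obtain ⟨n, hn, hmin⟩ := Recursive.exists_minimal (S := S) (P := fun n => m < power S b (n + 1))
    (by fun_prop) ⟨m, (lt_power hb m).trans_le (power_mono hb0 le_self_add)⟩
  have hn' : power S b n ≤ m := by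
    rcases (IsModel.models (S := S)).eq_zero_or_succ IsModel.nonempty n with rfl | ⟨t, rfl⟩
    · rw [power_zero]
      exact one_le_of_pos S hm
    · exact not_lt.1 (hmin t ((lt_add_one_iff S).2 le_rfl))
  obtain ⟨k, r, hr, rfl⟩ := exists_eq_mul_add S (power_pos (S := S) hb0 n) m
  refine ⟨n, k, r, rfl, ?_, ?_, hr⟩
  · refine pos_of_ne_zero ?_
    rintro rfl
    rw [mul_zero, zero_add] at hn'
    exact hn'.not_gt hr
  · by_contra! h
    refine hn.not_ge ?_
    calc power S b (n + 1) = power S b n * b := power_succ b n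
      _ ≤ power S b n * k := by gcongr
      _ ≤ _ := le_self_add

theorem representation_unique {b n k r n' k' r' : M} (hb : 0 < b) (hk : 0 < k) (hkb : k < b)
    (hr : r < power S b n) (hk' : 0 < k') (hkb' : k' < b) (hr' : r' < power S b n')
    (h : power S b n * k + r = power S b n' * k' + r') : n = n' ∧ k = k' ∧ r = r' := by
  have key : ∀ {n k r n' k' r' : M}, k < b → r < power S b n → 0 < k' →
      power S b n * k + r = power S b n' * k' + r' → n' ≤ n := by
    intro n k r n' k' r' hkb hr hk' h
    by_contra! hlt
    refine h.not_lt ?_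
    calc power S b n * k + r < power S b (n + 1) := power_mul_add_lt hkb hr
      _ ≤ power S b n' := power_mono hb ((add_one_le_iff S).2 hlt)
      _ ≤ _ := power_le_power_mul_add hk'
  obtain rfl : n = n' := le_antisymm (key hkb' hr' hk h.symm) (key hkb hr hk' h)
  exact ⟨rfl, mul_add_inj S hr hr' h⟩

theorem exponent_lt {b n k r : M} (hb : 1 < b) (hk : 0 < k) : n < power S b n * k + r :=
  (lt_power hb n).trans_le (power_le_power_mul_add hk)

theorem remainder_lt {b n k r : M} (hk : 0 < k) (hr : r < power S b n) :
    r < power S b n * k + r :=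
  hr.trans_le (power_le_power_mul_add hk)

/-- Induction along complete representations in the base `b`. -/
theorem Recursive.base_induction {b : M} (hb : 1 < b) {P : M → Prop} (hP : Recursive S P)
    (h0 : P 0) (h1 : ∀ n k r, 0 < k → k < b → r < SecondOrderArith.power S b n → P n → P r →
      P (SecondOrderArith.power S b n * k + r)) (m : M) : P m := by
  refine hP.strong_induction (fun m ih => ?_) m
  rcases (zero_le (a := m)).eq_or_lt with rfl | hm
  · exact h0
  · obtain ⟨n, k, r, rfl, hk, hkb, hr⟩ := exists_representation S hb hm
    exact h1 n k r hk hkb hr (ih n (exponent_lt hb hk)) (ih r (remainder_lt hk hr))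

variable (S) in
theorem exists_repr : ∃ o : M → M → M, Recursive S (fun p : M × M => o p.1 p.2) ∧
    (∀ b, o b 0 = 0) ∧ ∀ b n k r, 1 < b → 0 < k → k < b → r < power S b n →
      o b (power S b n * k + r) = oadd (o b n) k (o b r) := by
  obtain ⟨w, hw, hw'⟩ := Recursive.exists_function (S := S) (α := M × M)
    (P := fun p w => ¬ 1 < p.1 ∨ p.2 = 0 ∨ (p.2 = power S p.1 (expo S w) * coef S w + tail S w ∧
      0 < coef S w ∧ coef S w < p.1 ∧ tail S w < power S p.1 (expo S w))) (by fun_prop)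
    (by
      rintro ⟨b, m⟩
      by_cases hb : 1 < b
      · by_cases hm : m = 0
        · exact ⟨0, Or.inr (Or.inl hm)⟩
        · obtain ⟨n, k, r, h⟩ := exists_representation S hb (pos_of_ne_zero hm)
          exact ⟨oadd n k r, Or.inr (Or.inr (by simpa using h))⟩
      · exact ⟨0, Or.inl hb⟩)
  classical
  obtain ⟨o, ho, ho'⟩ := exists_course_of_values_recursion (S := S) (α := M)
    (G := fun b m c => if m = 0 then 0 else
      oadd (entry S c (expo S (w (b, m)))) (coef S (w (b, m))) (entry S c (tail S (w (b, m)))))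
    (by fun_prop)
  refine ⟨o, ho, fun b => ?_, fun b n k r hb hk hkb hr => ?_⟩
  · obtain ⟨c, -, h⟩ := ho' b 0
    rw [h, if_pos rfl]
  · obtain ⟨c, hc, h⟩ := ho' b (power S b n * k + r)
    have hpos : 0 < power S b n * k + r := zero_le.trans_lt (exponent_lt hb hk)
    obtain ⟨h1, h2, h3, h4⟩ := ((hw' (b, power S b n * k + r)).resolve_left
      (not_not.2 hb)).resolve_left hpos.ne'
    obtain ⟨e1, e2, e3⟩ := representation_unique (one_pos.trans hb) hk hkb hr h2 h3 h4 h1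
    rw [h, if_neg hpos.ne', ← e1, ← e2, ← e3, hc _ (exponent_lt hb hk), hc _ (remainder_lt hk hr)]

variable (S) in
/-- The code of the term that results from the complete representation of `m` in the base `b` by
replacing `b` by `ω`, for `b ≥ 2`. -/
noncomputable def toOrd (b m : M) : M := (exists_repr S).choose b m

@[fun_prop]
theorem Recursive.toOrd {f g : α → M} (hf : Recursive S f) (hg : Recursive S g) :
    Recursive S (fun a => toOrd S (f a) (g a)) :=
  (exists_repr S).choose_spec.1.comp (hf.prodMk hg)

@[simp]
theorem toOrd_zero (b : M) : toOrd S b 0 = 0 := (exists_repr S).choose_spec.2.1 b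

theorem toOrd_power_mul_add {b n k r : M} (hb : 1 < b) (hk : 0 < k) (hkb : k < b)
    (hr : r < power S b n) :
    toOrd S b (power S b n * k + r) = oadd (toOrd S b n) k (toOrd S b r) :=
  (exists_repr S).choose_spec.2.2 b n k r hb hk hkb hr

variable (S) in
theorem exists_eval : ∃ T : M → M → M, Recursive S (fun p : M × M => T p.1 p.2) ∧
    (∀ b, T b 0 = 0) ∧ ∀ b e k a, T b (oadd e k a) = power S b (T b e) * k + T b a := by
  classical
  obtain ⟨T, hT, hT'⟩ := exists_course_of_values_recursion (S := S) (α := M)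
    (G := fun b x c => if x = 0 then 0 else
      power S b (entry S c (expo S x)) * coef S x + entry S c (tail S x)) (by fun_prop)
  refine ⟨T, hT, fun b => ?_, fun b e k a => ?_⟩
  · obtain ⟨c, -, h⟩ := hT' b 0
    rw [h, if_pos rfl]
  · obtain ⟨c, hc, h⟩ := hT' b (oadd e k a)
    rw [h, if_neg (oadd_ne_zero e k a), expo_oadd, coef_oadd, tail_oadd,
      hc _ (lt_oadd_expo S e k a), hc _ (lt_oadd_tail S e k a)]

variable (S) in
/-- The value of the term with the code `x` if `ω` is replaced by `b`. Only its values at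
codes of terms matter. -/
noncomputable def evalOrd (b x : M) : M := (exists_eval S).choose b x

@[fun_prop]
theorem Recursive.evalOrd {f g : α → M} (hf : Recursive S f) (hg : Recursive S g) :
    Recursive S (fun a => evalOrd S (f a) (g a)) :=
  (exists_eval S).choose_spec.1.comp (hf.prodMk hg)

@[simp]
theorem evalOrd_zero (b : M) : evalOrd S b 0 = 0 := (exists_eval S).choose_spec.2.1 b

theorem evalOrd_oadd (b e k a : M) : evalOrd S b (oadd e k a) =
    power S b (evalOrd S b e) * k + evalOrd S b a :=
  (exists_eval S).choose_spec.2.2 b e k a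

/-- Replacing the base by `ω` preserves the order: the complete representations of numbers are
compared lexicographically, as Cantor normal forms are. -/
theorem toOrd_lt_toOrd {b : M} (hb : 1 < b) {m m' : M} (h : m < m') :
    OrdLt S (toOrd S b m) (toOrd S b m') := by
  refine Recursive.pair_induction (S := S)
    (P := fun m m' => m < m' → OrdLt S (toOrd S b m) (toOrd S b m'))
    (.imp (by fun_prop) (by fun_prop)) (fun m m' ih h => ?_) m m' h
  obtain ⟨n', k', r', rfl, hk', hkb', hr'⟩ := exists_representation S hb (zero_le.trans_lt h)
  rw [toOrd_power_mul_add hb hk' hkb' hr']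
  rcases (zero_le (a := m)).eq_or_lt with rfl | hm
  · rw [toOrd_zero]
    exact zero_ordLt_oadd _ _ _
  obtain ⟨n, k, r, rfl, hk, hkb, hr⟩ := exists_representation S hb hm
  rw [toOrd_power_mul_add hb hk hkb hr, oadd_ordLt_oadd]
  have hlt : ∀ {n k r n' k' r' : M}, k < b → r < power S b n → 0 < k' → n < n' →
      power S b n * k + r < power S b n' * k' + r' := by
    intro n k r n' k' r' hkb hr hk' hn
    calc power S b n * k + r < power S b (n + 1) := power_mul_add_lt hkb hr
      _ ≤ power S b n' := power_mono (one_pos.trans hb) ((add_one_le_iff S).2 hn)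
      _ ≤ _ := power_le_power_mul_add hk'
  rcases lt_trichotomy n n' with hn | rfl | hn
  · exact Or.inl (ih n (exponent_lt hb hk) n' (exponent_lt hb hk') hn)
  · refine Or.inr ⟨rfl, ?_⟩
    rcases lt_trichotomy k k' with hkk | rfl | hkk
    · exact Or.inl hkk
    · exact Or.inr ⟨rfl, ih r (remainder_lt hk hr) r' (remainder_lt hk' hr')
        (lt_of_add_lt_add_left h)⟩
    · refine absurd h (not_lt.2 ?_)
      calc power S b n * k' + r' ≤ power S b n * k' + power S b n := by gcongr
        _ = power S b n * (k' + 1) := by ring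
        _ ≤ power S b n * k := by
          gcongr
          exact (add_one_le_iff S).2 hkk
        _ ≤ _ := le_self_add
  · exact absurd h (hlt hkb' hr' hk hn).not_gt

theorem bddCNF_toOrd {b : M} (hb : 1 < b) (m : M) : BddCNF S b (toOrd S b m) := by
  refine Recursive.base_induction hb (S := S) (P := fun m => BddCNF S b (toOrd S b m))
    (by fun_prop) ?_ ?_ m
  · rw [toOrd_zero]
    exact bddCNF_zero b
  · intro n k r hk hkb hr hn hr'
    rw [toOrd_power_mul_add hb hk hkb hr, bddCNF_oadd]
    refine ⟨hn, hk, hkb, hr', ?_⟩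
    rcases (zero_le (a := r)).eq_or_lt with rfl | hr0
    · exact Or.inl (toOrd_zero b)
    · obtain ⟨n', k', r', rfl, hk', hkb', hr''⟩ := exists_representation S hb hr0
      refine Or.inr ⟨_, _, _, toOrd_power_mul_add hb hk' hkb' hr'', toOrd_lt_toOrd hb ?_⟩
      by_contra! hle
      refine hr.not_ge ?_
      exact (power_mono (one_pos.trans hb) hle).trans (power_le_power_mul_add hk')

/-- A bounded Cantor normal form is recovered from its value at the bound. The remainder `a` of a
term with the leading exponent `e` has a value below `b ^ e`, since otherwise monotonicity of
`toOrd` would give `ω ^ e ≤ a`. -/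
theorem toOrd_evalOrd {b x : M} (hb : 1 < b) (hx : BddCNF S b x) :
    toOrd S b (evalOrd S b x) = x := by
  refine hx.induction (P := fun x => toOrd S b (evalOrd S b x) = x) (by fun_prop) (by simp) ?_
  intro e k a _ hk hkb _ hea he ha
  rw [evalOrd_oadd, toOrd_power_mul_add hb hk hkb ?_, he, ha]
  rcases hea with rfl | ⟨e', k', a', rfl, hlt⟩
  · rw [evalOrd_zero]
    exact power_pos (one_pos.trans hb) _
  · by_contra! hle
    have h1 : toOrd S b (power S b (evalOrd S b e)) = oadd e 1 0 := by
      have := toOrd_power_mul_add (S := S) (r := 0) hb one_pos hb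
        (power_pos (one_pos.trans hb) (evalOrd S b e))
      rwa [mul_one, add_zero, he, toOrd_zero] at this
    rcases hle.lt_or_eq with h | h
    · have h2 := toOrd_lt_toOrd (S := S) hb h
      rw [h1, ha, oadd_ordLt_oadd] at h2
      rcases h2 with h2 | ⟨rfl, -⟩
      · exact h2.asymm hlt
      · exact OrdLt.irrefl _ hlt
    · rw [h, ha, oadd_inj S] at h1
      rw [h1.1] at hlt
      exact OrdLt.irrefl _ hlt

theorem evalOrd_lt_evalOrd {b x y : M} (hb : 1 < b) (hx : BddCNF S b x) (hy : BddCNF S b y)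
    (h : OrdLt S x y) : evalOrd S b x < evalOrd S b y := by
  by_contra! hle
  rcases hle.lt_or_eq with h' | h'
  · have := toOrd_lt_toOrd (S := S) hb h'
    rw [toOrd_evalOrd hb hx, toOrd_evalOrd hb hy] at this
    exact h.asymm this
  · have := congrArg (toOrd S b) h'
    rw [toOrd_evalOrd hb hx, toOrd_evalOrd hb hy] at this
    rw [this] at h
    exact OrdLt.irrefl _ h

end Representations

/-! ### Base change and the equivalence -/

section Equivalence

variable {M : Type u} [CommSemiring M] [LinearOrder M] [IsStrictOrderedRing M]
  [CanonicallyOrderedAdd M] {S : Set (Set M)} [hS : IsModel S]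

/-- Changing the base from `b` to `c` is replacing `b` by `ω` and then `ω` by `c`. -/
theorem isBaseChange_iff {b c m s : M} (hb : 1 < b) :
    IsBaseChange S b c m s ↔ s = evalOrd S c (toOrd S b m) := by
  constructor
  · rintro ⟨h, hh, h0, h1, rfl⟩
    have hh' : Recursive S h := hh
    refine Recursive.base_induction hb (S := S) (P := fun m => h m = evalOrd S c (toOrd S b m))
      (by fun_prop) ?_ ?_ m
    · rw [h0, toOrd_zero, evalOrd_zero]
    · intro n k r hk hkb hr hn hr'
      obtain ⟨q, hq, hqr⟩ := h1 n k r _ (isPow_iff.2 rfl) hk hkb hr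
      rw [hqr, isPow_iff.1 hq, toOrd_power_mul_add hb hk hkb hr, evalOrd_oadd, hn, hr']
  · rintro rfl
    refine ⟨fun m => evalOrd S c (toOrd S b m), recursive_iff_isFunctionOf.1 (by fun_prop), ?_, ?_,
      rfl⟩
    · simp only [toOrd_zero, evalOrd_zero]
    · intro n k r p hp hk hkb hr
      obtain rfl := isPow_iff.1 hp
      refine ⟨_, isPow_iff.2 rfl, ?_⟩
      dsimp only
      rw [toOrd_power_mul_add hb hk hkb hr, evalOrd_oadd]

theorem le_iff_le {x y : M} : Le x y ↔ x ≤ y := le_iff_lt_or_eq.symm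

/-- A Goodstein sequence that does not terminate yields a descending sequence of ordinals: replace
the `i`-th base by `ω` in the `i`-th term. -/
theorem NoDescendingSeq.goodsteinTermination (h : NoDescendingSeq S) : GoodsteinTermination S := by
  intro f hf hmono hf0 g hg hgood
  by_contra hcon
  refine h ?_
  have hf' : Recursive S f := hf
  have hg' : Recursive S g := hg
  have hle : ∀ {i j}, i ≤ j → f i ≤ f j := fun hij => le_iff_le.1 (hmono _ _ (le_iff_le.2 hij))
  have hb : ∀ i, 1 < f i := fun i =>
    (add_one_le_iff S).1 ((le_iff_le.1 hf0).trans (hle zero_le))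
  have hstep : ∀ i, IsPred (evalOrd S (f (i + 1)) (toOrd S (f i) (g i))) (g (i + 1)) := by
    intro i
    obtain ⟨s, hs, hs'⟩ := hgood i
    rwa [(isBaseChange_iff (hb i)).1 hs] at hs'
  have hzero : ∀ i, g i = 0 → g (i + 1) = 0 := by
    intro i hi
    have := hstep i
    rw [hi, toOrd_zero, evalOrd_zero] at this
    rcases this with h | h
    · exact h.2
    · exact absurd h.symm (hS.models.succ_ne_zero _)
  have hne : ∀ i, g i ≠ 0 := by
    intro k hk
    refine hcon ⟨k, fun i hi => ?_⟩
    obtain ⟨t, rfl⟩ := exists_add_of_le (le_iff_le.1 hi)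
    refine Recursive.induction (S := S) (P := fun t => g (k + t) = 0) (by fun_prop) ?_ ?_ t
    · rwa [add_zero]
    · intro t ht
      rw [← add_assoc]
      exact hzero _ ht
  refine ⟨fun i => toOrd S (f i) (g i), recursive_iff_isFunctionOf.1 (by fun_prop),
    fun i => (bddCNF_toOrd (hb i) (g i)).isCNF, fun i => ?_⟩
  have hb' := hb (i + 1)
  have h1 : g (i + 1) < evalOrd S (f (i + 1)) (toOrd S (f i) (g i)) := by
    rcases hstep i with h | h
    · exact absurd h.2 (hne _)
    · rw [h]
      exact (lt_add_one_iff S).2 le_rfl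
  have h2 := toOrd_lt_toOrd (S := S) hb' h1
  rwa [toOrd_evalOrd hb' ((bddCNF_toOrd (hb i) (g i)).mono (hle le_self_add))] at h2

/-- A descending sequence `α` of ordinals yields a Goodstein sequence that does not terminate. With
bases `f i` that exceed all coefficients in `α 0, …, α i`, the Goodstein sequence that starts with
the value of `α 0` dominates the values of the `α i` at `f i`. -/
theorem GoodsteinTermination.noDescendingSeq (h : GoodsteinTermination S) : NoDescendingSeq S := by
  rintro ⟨α, hα, hcnf, hdesc⟩
  have hα' : Recursive S α := hα
  obtain ⟨F, hF, hF0, hF1⟩ := exists_primitive_recursion (S := S) (α := M)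
    (g := fun _ => 1 + 1 + α 0) (h := fun _ i y => y + α (i + 1)) (by fun_prop) (by fun_prop)
  obtain ⟨f, hf, hf0, hf1⟩ : ∃ f : M → M, Recursive S f ∧ f 0 = 1 + 1 + α 0 ∧
      ∀ i, f (i + 1) = f i + α (i + 1) :=
    ⟨F 0, hF.comp (f := fun i : M => (0, i)) (by fun_prop), hF0 0, hF1 0⟩
  have hle : ∀ i j, i ≤ j → f i ≤ f j := by
    intro i j hij
    obtain ⟨t, rfl⟩ := exists_add_of_le hij
    refine Recursive.induction (S := S) (P := fun t => f i ≤ f (i + t)) (by fun_prop)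
      (by rw [add_zero]) ?_ t
    intro t ht
    rw [← add_assoc, hf1]
    exact ht.trans le_self_add
  have h2 : 1 + 1 ≤ f 0 := by
    rw [hf0]
    exact le_self_add
  have hb : ∀ i, 1 < f i := fun i => (add_one_le_iff S).1 (h2.trans (hle 0 i zero_le))
  have hαf : ∀ i, α i ≤ f i := by
    intro i
    rcases hS.models.eq_zero_or_succ hS.nonempty i with rfl | ⟨j, rfl⟩
    · rw [hf0]
      exact le_add_self
    · rw [hf1]
      exact le_add_self
  have hbdd : ∀ i, BddCNF S (f i) (α i) := fun i => (hcnf i).bddCNF (hαf i)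
  obtain ⟨p, hp, hp'⟩ := exists_pred S
  obtain ⟨G, hG, hG0, hG1⟩ := exists_primitive_recursion (S := S) (α := M)
    (g := fun _ => evalOrd S (f 0) (α 0))
    (h := fun _ i y => p (evalOrd S (f (i + 1)) (toOrd S (f i) y))) (by fun_prop) (by fun_prop)
  obtain ⟨g, hg, hg0, hg1⟩ : ∃ g : M → M, Recursive S g ∧ g 0 = evalOrd S (f 0) (α 0) ∧
      ∀ i, g (i + 1) = p (evalOrd S (f (i + 1)) (toOrd S (f i) (g i))) :=
    ⟨G 0, hG.comp (f := fun i : M => (0, i)) (by fun_prop), hG0 0, hG1 0⟩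
  obtain ⟨k, hk⟩ := h f (recursive_iff_isFunctionOf.1 hf)
    (fun i j hij => le_iff_le.2 (hle i j (le_iff_le.1 hij))) (le_iff_le.2 h2) g
    (recursive_iff_isFunctionOf.1 hg)
    (fun i => ⟨_, (isBaseChange_iff (hb i)).2 rfl, by rw [hg1]; exact hp' _⟩)
  have hdom : ∀ i, evalOrd S (f i) (α i) ≤ g i := by
    intro i
    refine Recursive.induction (S := S) (P := fun i => evalOrd S (f i) (α i) ≤ g i) (by fun_prop)
      hg0.ge ?_ i
    intro i hi
    have hmono := hle i (i + 1) le_self_add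
    have h3 : evalOrd S (f (i + 1)) (α (i + 1)) < evalOrd S (f (i + 1)) (α i) :=
      evalOrd_lt_evalOrd (hb _) (hbdd _) ((hbdd i).mono hmono) (hdesc i)
    have h4 : evalOrd S (f (i + 1)) (α i) ≤ evalOrd S (f (i + 1)) (toOrd S (f i) (g i)) := by
      rcases hi.lt_or_eq with hi | hi
      · have := toOrd_lt_toOrd (S := S) (hb i) hi
        rw [toOrd_evalOrd (hb i) (hbdd i)] at this
        exact (evalOrd_lt_evalOrd (hb _) ((hbdd i).mono hmono)
          ((bddCNF_toOrd (hb i) _).mono hmono) this).le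
      · rw [← hi, toOrd_evalOrd (hb i) (hbdd i)]
    rcases hp' (evalOrd S (f (i + 1)) (toOrd S (f i) (g i))) with h | h
    · exact absurd (h3.trans_le h4) (by rw [h.1]; exact not_lt_zero)
    · rw [← hg1] at h
      refine (lt_add_one_iff S).1 ?_
      rw [← h]
      exact h3.trans_le h4
  have hpos : OrdLt S 0 (α k) := by
    refine ordLt_iff.2 (Or.inl ⟨rfl, fun h0 => ?_⟩)
    have := hdesc k
    rw [h0] at this
    exact not_ordLt_zero this
  have hlt := evalOrd_lt_evalOrd (hb k) (bddCNF_zero _) (hbdd k) hpos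
  refine absurd (hlt.trans_le (hdom k)) ?_
  rw [hk k (Or.inr rfl)]
  exact not_lt_zero

end Equivalence

/-- Without sets there are no functions of the model, and both statements hold trivially. -/
theorem goodsteinTermination_iff_of_eq_empty {M : Type u} [Zero M] [One M] [Add M] [Mul M] [LT M] :
    GoodsteinTermination (∅ : Set (Set M)) ↔ NoDescendingSeq (∅ : Set (Set M)) :=
  ⟨fun _ ⟨_, hα, _⟩ => hα, fun _ _ hf => absurd hf (Set.notMem_empty _)⟩

end SecondOrderArith

theorem mainTheorem4 {M : Type u} [Zero M] [One M] [Add M] [Mul M] [LT M] (S : Set (Set M))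
    (hS : SecondOrderArith.ModelsRCA0 S) :
    SecondOrderArith.GoodsteinTermination S ↔ SecondOrderArith.NoDescendingSeq S := by
  rcases S.eq_empty_or_nonempty with rfl | hne
  · exact SecondOrderArith.goodsteinTermination_iff_of_eq_empty
  let _ := hS.commSemiring hne
  let _ := hS.linearOrder hne
  have : IsStrictOrderedRing M := SecondOrderArith.ModelsRCA0.isStrictOrderedRing (S := S) hS hne
  have : CanonicallyOrderedAdd M :=
    SecondOrderArith.ModelsRCA0.canonicallyOrderedAdd (S := S) hS hne
  have : SecondOrderArith.IsModel S := ⟨hS, hne⟩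
  exact ⟨fun h => SecondOrderArith.GoodsteinTermination.noDescendingSeq (S := S) h,
    fun h => SecondOrderArith.NoDescendingSeq.goodsteinTermination (S := S) h⟩
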